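/- Let $g(\varphi)=-\sin(\varphi-\alpha)+r\sin 2\varphi$ and consider, for $\omega,\varepsilon\in\mathbb R$, the four-oscillator network on $\mathbb T^4=(\mathbb R/2\pi\mathbb Z)^4$ \[ \begin{aligned} \dot\theta_1&=\omega+g(\theta_1-\theta_3)+g(0)+\varepsilon\,(g(\theta_1-\theta_2)+g(\theta_1-\theta_4)),\\ \dot\theta_2&=\omega+g(\theta_2-\theta_4)+g(0)+\varepsilon\,(g(\theta_2-\theta_3)+g(\theta_2-\theta_1)),\\ \dot\theta_3&=\omega+g(\theta_3-\theta_1)+g(0)+\varepsilon\,(g(\theta_3-\theta_2)+g(\theta_3-\theta_4)),\\ \dot\theta_4&=\omega+g(\theta_4-\theta_2)+g(0)+\varepsilon\,(g(\theta_4-\theta_1)+g(\theta_4-\theta_3)), \end{aligned} \] with phase differences $(\varphi_1,\varphi_2,\varphi_3)=(\theta_1-\theta_3,\theta_2-\theta_4,\theta_1-\theta_2)\in\mathbb T^3$. For a trajectory put $\Omega_{ij}=\lim_{T\to\infty}(\theta_i(T)-\theta_j(T))/T$ (continuous real representatives). A weak chimera is a nonempty, connected, chain-recurrent, flow-invariant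 set $A\subset\mathbb T^4$ such that on each trajectory in $A$ there are $i,j,k$, $k\ne i$, with $\Omega_{ij}$ existing and nonzero and $\Omega_{ik}=0$. A compact invariant set is attracting if it is asymptotically stable. The set of $(r,\alpha)\in\mathbb R^2$ with $r<-|\cos\alpha|/2$ and $\alpha\notin\pi\mathbb Z$ is open and nonempty, and for every such $(r,\alpha)$ the following hold. (i) For $\varepsilon=0$, the trajectory with initial phase differences $(0,\pi,\xi)$ has phase differences $(0,\pi,2\sin\alpha\cdot t+\xi)$ for all $t$, and the set $A_0\subset\mathbb T^4$ of states with phase differences on this periodic orbit is an attracting weak chimera. (ii) It persists: there are $\varepsilon_0=\varepsilon_0(r,\alpha)>0$, an open set $U\subset\mathbb T^4$ and sets $A_\varepsilon\subset U$ for $|\varepsilon|<\varepsilon_0$, independent of $\omega$ and equal to $A_0$ above for $\varepsilon=0$, such that $A_\varepsilon\to A_0$ in the Hausdorff distance as $\varepsilon\to0$ and, for every $|\varepsilon|<\varepsilon_0$ and every $\omega$, the set $A_\varepsilon$ is an attracting weak chimera, it is the set of all states whose phase differences lie on some periodic orbit of the phase-difference system, and it contains every flow-invariant subset of $U$. (iii)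 For $|\varepsilon|<\varepsilon_0$, on every trajectory in $A_\varepsilon$ the oscillators $1,3$ are in phase ($\theta_1=\theta_3$), $\Omega_{13}=\Omega_{24}=0$, and $\Omega_{12}$ exists and is nonzero; for $\varepsilon=0$ the oscillators $2,4$ are in anti-phase ($\theta_2=\theta_4+\pi$). -/

import Mathlib

open Filter Topology

/-- The `N`-torus of phases, `(ℝ / 2πℤ)^N`, with the sup metric. -/
abbrev PhaseTorus (N : ℕ) : Type := Fin N → AddCircle (2 * Real.pi)

/-- The point of the torus represented by a vector of real phases. -/
noncomputable def toTorus {N : ℕ} (v : Fin N → ℝ) : PhaseTorus N :=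
  fun i => ((v i : ℝ) : AddCircle (2 * Real.pi))

/-- A network of `N` coupled phase oscillators: natural frequencies, coupling strengths, and
a smooth `2π`-periodic coupling function. -/
structure OscillatorNetwork (N : ℕ) where
  freq : Fin N → ℝ
  strength : Matrix (Fin N) (Fin N) ℝ
  coupling : ℝ → ℝ
  smooth : ContDiff ℝ (⊤ : ℕ∞) coupling
  periodic : Function.Periodic coupling (2 * Real.pi)

namespace OscillatorNetwork

variable {N : ℕ}

/-- `θ : ℝ → ℝ^N` consists of continuous real representatives of the phases along a solution of
`θ_i' = ω_i + ∑_j K_ij g(θ_i - θ_j)`, defined for all time. -/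
def IsSolution (S : OscillatorNetwork N) (θ : ℝ → Fin N → ℝ) : Prop :=
  ∀ (t : ℝ) (i : Fin N),
    HasDerivAt (fun s => θ s i)
      (S.freq i + ∑ j, S.strength i j * S.coupling (θ t i - θ t j)) t

/-- Every trajectory that starts in `A` stays in `A` for all (positive and negative) times. -/
def FlowInvariant (S : OscillatorNetwork N) (A : Set (PhaseTorus N)) : Prop :=
  ∀ θ : ℝ → Fin N → ℝ, S.IsSolution θ → toTorus (θ 0) ∈ A → ∀ t : ℝ, toTorus (θ t) ∈ A

/-- One link of a `(δ, T)`-chain inside `A`: follow the flow from `x` for a time at least `T`,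
then jump by less than `δ` to `y`. -/
def ChainStep (S : OscillatorNetwork N) (A : Set (PhaseTorus N)) (δ T : ℝ)
    (x y : PhaseTorus N) : Prop :=
  x ∈ A ∧ y ∈ A ∧ ∃ θ : ℝ → Fin N → ℝ, S.IsSolution θ ∧ toTorus (θ 0) = x ∧
    ∃ t : ℝ, T ≤ t ∧ dist (toTorus (θ t)) y < δ

/-- The flow restricted to `A` is chain recurrent: for all `δ, T > 0` each point of `A` is joined
to itself by a `(δ, T)`-chain of points of `A`. -/
def ChainRecurrentOn (S : OscillatorNetwork N) (A : Set (PhaseTorus N)) : Prop :=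
  ∀ x ∈ A, ∀ δ > 0, ∀ T > 0, Relation.TransGen (S.ChainStep A δ T) x x

end OscillatorNetwork

/-- `Ω_ij = lim_{T → ∞} (θ_i(T) - θ_j(T)) / T` exists and equals `c`. -/
def HasFrequencyDifference {N : ℕ} (θ : ℝ → Fin N → ℝ) (i j : Fin N) (c : ℝ) : Prop :=
  Tendsto (fun T : ℝ => (θ T i - θ T j) / T) atTop (𝓝 c)

namespace OscillatorNetwork

variable {N : ℕ}

/-- Weak chimera state: a (nonempty) connected chain-recurrent flow-invariant set such that on each
trajectory in it there are oscillators `i, j, k` with `Ω_ij ≠ 0` and `Ω_ik = 0`, `k ≠ i`. -/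
structure IsWeakChimera (S : OscillatorNetwork N) (A : Set (PhaseTorus N)) : Prop where
  connected : IsConnected A
  invariant : S.FlowInvariant A
  chainRecurrent : S.ChainRecurrentOn A
  partialSync : ∀ θ : ℝ → Fin N → ℝ, S.IsSolution θ → (∀ t : ℝ, toTorus (θ t) ∈ A) →
    ∃ i j k : Fin N, k ≠ i ∧ (∃ c : ℝ, c ≠ 0 ∧ HasFrequencyDifference θ i j c) ∧
      HasFrequencyDifference θ i k 0

/-- `A` is attracting: a compact invariant set that is Lyapunov stable and attracts all
trajectories from a neighbourhood, i.e. it is asymptotically stable. -/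
structure IsAttracting (S : OscillatorNetwork N) (A : Set (PhaseTorus N)) : Prop where
  compact : IsCompact A
  invariant : S.FlowInvariant A
  stable : ∀ V : Set (PhaseTorus N), IsOpen V → A ⊆ V →
    ∃ W : Set (PhaseTorus N), IsOpen W ∧ A ⊆ W ∧
      ∀ θ : ℝ → Fin N → ℝ, S.IsSolution θ → toTorus (θ 0) ∈ W →
        ∀ t : ℝ, 0 ≤ t → toTorus (θ t) ∈ V
  attracts : ∃ W : Set (PhaseTorus N), IsOpen W ∧ A ⊆ W ∧
    ∀ θ : ℝ → Fin N → ℝ, S.IsSolution θ → toTorus (θ 0) ∈ W →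
      Tendsto (fun t : ℝ => Metric.infDist (toTorus (θ t)) A) atTop (𝓝 0)

end OscillatorNetwork

/-- Hansel–Mato–Meunier coupling. -/
noncomputable def hmmCoupling (r α φ : ℝ) : ℝ :=
  -Real.sin (φ - α) + r * Real.sin (2 * φ)

theorem hmmCoupling_smooth (r α : ℝ) : ContDiff ℝ (⊤ : ℕ∞) (hmmCoupling r α) := by
  unfold hmmCoupling
  fun_prop

theorem hmmCoupling_periodic (r α : ℝ) : Function.Periodic (hmmCoupling r α) (2 * Real.pi) := by
  intro x
  unfold hmmCoupling
  have h1 : x + 2 * Real.pi - α = (x - α) + 2 * Real.pi := by ring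
  have h2 : 2 * (x + 2 * Real.pi) = 2 * x + 2 * Real.pi + 2 * Real.pi := by ring
  rw [h1, h2, Real.sin_add_two_pi, Real.sin_add_two_pi, Real.sin_add_two_pi]

/-- The four-oscillator network: oscillators `0, 2` are coupled with strength `1`, and so are
`1, 3`; the two pairs are coupled to each other with strength `ε`. -/
noncomputable def fourOscillator (ω r α ε : ℝ) : OscillatorNetwork 4 where
  freq := fun _ => ω
  strength := !![1, ε, 1, ε;
                 ε, 1, ε, 1;
                 1, ε, 1, ε;
                 ε, 1, ε, 1]
  coupling := hmmCoupling r α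
  smooth := hmmCoupling_smooth r α
  periodic := hmmCoupling_periodic r α

/-- The phase differences `(φ₁, φ₂, φ₃) = (θ₁ - θ₃, θ₂ - θ₄, θ₁ - θ₂)`, modulo `2π`
(the oscillators are indexed from `0` here). -/
noncomputable def phaseDiff (x : PhaseTorus 4) : PhaseTorus 3 :=
  ![x 0 - x 2, x 1 - x 3, x 0 - x 1]

/-- `γ` is a (nonconstant) periodic orbit of the system of phase differences. -/
def IsPhaseDiffPeriodicOrbit (S : OscillatorNetwork 4) (γ : Set (PhaseTorus 3)) : Prop :=
  ∃ θ : ℝ → Fin 4 → ℝ, S.IsSolution θ ∧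
    (∃ T : ℝ, 0 < T ∧ ∀ t : ℝ, phaseDiff (toTorus (θ (t + T))) = phaseDiff (toTorus (θ t))) ∧
    (∃ t : ℝ, phaseDiff (toTorus (θ t)) ≠ phaseDiff (toTorus (θ 0))) ∧
    γ = Set.range (fun t : ℝ => phaseDiff (toTorus (θ t)))

/-- The parameters `(r, α)` with `r < -|cos α| / 2` and `α ∉ πℤ`. -/
def chimeraRegion : Set (ℝ × ℝ) :=
  {p | p.1 < -|Real.cos p.2| / 2 ∧ ∀ k : ℤ, p.2 ≠ k * Real.pi}

/-- The states of the four oscillators whose phase differences lie on the circle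
`{(0, π, ξ) : ξ ∈ ℝ}`. -/
noncomputable def inAntiPhaseSet : Set (PhaseTorus 4) :=
  {x | ∃ ξ : ℝ, phaseDiff x = toTorus ![0, Real.pi, ξ]}

/-! Put `x = θ₁ - θ₃`, `y = θ₂ - θ₄`, `z = θ₁ - θ₂`. These differences satisfy an autonomous system
without `ω`. For `ε = 0` it reads `x' = G(x)`, `y' = G(y)`, `z' = g(x) - g(y)`, where `G(x) = g(x) -
g(-x) = -2 cos α sin x + 2r sin 2x`. The condition `r < -|cos α| / 2` says exactly that `G'(0)` and
`G'(π)` are negative, and `α ∉ πℤ` says that `z' = g(0) - g(π) = 2 sin α` does not vanish on the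
circle `x = 0`, `y = π`. So this circle is a periodic orbit that attracts in both transverse
directions.

For small `ε` the plane `x = 0` is still invariant, and near `y = π` the speed of `z` in it keeps
the sign `σ` of `sin α`. With `s = σ z` as new time and `u = y - π`, the motion in this plane
becomes one scalar equation `du/ds = F(u, s)`, periodic in `s` and contracting in `u`. Banach's
fixed point theorem gives a periodic solution `P` of size `O(ε)` (`exists_periodic_solution`,
`ContractionBounds.exists_invariantProfile`). The curve `(0, π + P(s), σ s)` is the continued
periodic orbit, and `A_ε` is its preimage in the 4-torus.

Everything about attraction comes from one Lyapunov function, `V = x² + (u - P(s))²`, which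
satisfies `V' ≤ -c V` while `|x|, |u| ≤ δ` (`ContractionBounds.lyapunov_deriv_le`). Forward in time
this gives asymptotic stability. Backward in time it makes `V` vanish on every full orbit that stays
in the strip, so `A_ε` contains every invariant subset of a neighbourhood that does not depend on
`ε`.

On `A_ε` the phase differences return after a time `T`, while all phases have gained a common amount
`ρ`. The return map is thus a rotation, and Dirichlet approximation gives recurrence. The
frequencies follow because `x` is constant and `y` bounded along lifts, while `z` gains `±2π` in
each period. -/

/-! ### Global existence of trajectories -/

section Trajectories

variable {E : Type*} [NormedAddCommGroup E] [NormedSpace ℝ E]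

/-- A bounded Lipschitz vector field is complete. -/
theorem exists_global_integralCurve [CompleteSpace E] {f : E → E} {K C : NNReal}
    (hf : LipschitzWith K f) (hC : ∀ x, ‖f x‖ ≤ C) (x₀ : E) :
    ∃ γ : ℝ → E, γ 0 = x₀ ∧ ∀ t, HasDerivAt γ (f (γ t)) t := by
  have key : ∀ n : ℕ, ∃ γ : ℝ → E, γ 0 = x₀ ∧
      ∀ t ∈ Set.Ioo (-(n + 1 : ℝ)) (n + 1), HasDerivAt γ (f (γ t)) t := by
    intro n
    have hn : (0 : ℝ) < n + 1 := by positivity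
    have h0 : (0 : ℝ) ∈ Set.Icc (-(n + 1 : ℝ)) (n + 1) := ⟨by linarith, hn.le⟩
    -- Speed at most `C` cannot leave the ball of radius `C (n + 1)` in time `n + 1`, so the
    -- Picard–Lindelöf interval has no smallness restriction.
    have hpl : IsPicardLindelof (fun _ => f) (⟨0, h0⟩ : Set.Icc (-(n + 1 : ℝ)) (n + 1)) x₀
        (C * (n + 1)) 0 C K := by
      refine IsPicardLindelof.of_time_independent (fun x _ => hC x) hf.lipschitzOnWith ?_
      simp
    obtain ⟨γ, h1, h2⟩ := hpl.exists_eq_forall_mem_Icc_hasDerivWithinAt₀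
    exact ⟨γ, h1, fun t ht => (h2 t (Set.Ioo_subset_Icc_self ht)).hasDerivAt
      (Icc_mem_nhds ht.1 ht.2)⟩
  choose γ h0 hγ using key
  have agree : ∀ m n : ℕ, m ≤ n → Set.EqOn (γ m) (γ n) (Set.Ioo (-(m + 1 : ℝ)) (m + 1)) := by
    intro m n hmn
    have hmn' : (m : ℝ) ≤ n := by exact_mod_cast hmn
    have hm : (0 : ℝ) < m + 1 := by positivity
    refine ODE_solution_unique_of_mem_Ioo (v := fun _ => f) (s := fun _ => Set.univ) (K := K)
      (t₀ := 0) (fun t _ => hf.lipschitzOnWith) ⟨by linarith, hm⟩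
      (fun t ht => ⟨hγ m t ht, trivial⟩) (fun t ht => ⟨hγ n t ?_, trivial⟩) ((h0 m).trans (h0 n).symm)
    exact ⟨by linarith [ht.1], by linarith [ht.2]⟩
  have mem : ∀ (t : ℝ) (n : ℕ), |t| ≤ n → t ∈ Set.Ioo (-(n + 1 : ℝ)) (n + 1) := by
    intro t n h
    have := abs_le.mp h
    exact ⟨by linarith, by linarith⟩
  -- The glued curve uses at time `t` the piece of index `⌈|t|⌉`. That piece is defined on an open
  -- interval around `t`, where it agrees with the glued curve.
  refine ⟨fun t => γ ⌈|t|⌉₊ t, by simp [h0], fun t => ?_⟩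
  have ht := mem t _ (Nat.le_ceil |t|)
  have hev : (fun s => γ ⌈|s|⌉₊ s) =ᶠ[𝓝 t] γ ⌈|t|⌉₊ := by
    filter_upwards [Ioo_mem_nhds ht.1 ht.2] with s hs
    rcases le_total ⌈|s|⌉₊ ⌈|t|⌉₊ with h | h
    · exact agree _ _ h (mem s _ (Nat.le_ceil _))
    · exact (agree _ _ h hs).symm
  exact (hγ _ t ht).congr_of_eventuallyEq hev

end Trajectories

/-! ### Periodic scalar flows and rotation numbers -/

section ScalarFlow

/-- The flow of a positive periodic scalar field: a solution through the origin that runs through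
the whole line and gains one period of the field per unit of its own period. -/
theorem exists_periodic_scalar_flow {k : ℝ → ℝ} {p : ℝ} (hk : Continuous k) (hpos : ∀ s, 0 < k s)
    (hp : 0 < p) (hper : Function.Periodic k p) :
    ∃ (T : ℝ) (s : ℝ → ℝ), 0 < T ∧ (∀ t, HasDerivAt s (k (s t)) t) ∧ (∀ t, s (t + T) = s t + p) ∧
      Function.Surjective s := by
  have hinv : Continuous fun s => (k s)⁻¹ := hk.inv₀ fun s => (hpos s).ne'
  have hperi : Function.Periodic (fun s => (k s)⁻¹) p := fun s => by simp [hper s]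
  have hii : ∀ a b, IntervalIntegrable (fun s => (k s)⁻¹) MeasureTheory.volume a b :=
    fun a b => hinv.intervalIntegrable a b
  -- `τ x` is the time the flow needs to go from `0` to `x`; the solution is its inverse, and the
  -- period is `τ p`.
  let τ : ℝ → ℝ := fun x => ∫ s in (0 : ℝ)..x, (k s)⁻¹
  have hτ : ∀ x, HasDerivAt τ (k x)⁻¹ x := fun x =>
    intervalIntegral.integral_hasDerivAt_right (hii _ _) (hinv.stronglyMeasurableAtFilter _ _)
      hinv.continuousAt
  have hmono : StrictMono τ := strictMono_of_deriv_pos fun x => by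
    rw [(hτ x).deriv]; exact inv_pos.mpr (hpos x)
  have hcont : Continuous τ := continuous_iff_continuousAt.mpr fun x => (hτ x).continuousAt
  have hsurj : Function.Surjective τ := hcont.surjective
    (hperi.tendsto_atTop_intervalIntegral_of_pos' (hii _ _) (fun x => inv_pos.mpr (hpos x)) hp)
    (hperi.tendsto_atBot_intervalIntegral_of_pos' (hii _ _) (fun x => inv_pos.mpr (hpos x)) hp)
  let e : ℝ ≃o ℝ := hmono.orderIsoOfSurjective τ hsurj
  have he : ∀ x, τ (e.symm x) = x := fun x => e.apply_symm_apply x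
  have he' : ∀ x, e.symm (τ x) = x := fun x => e.symm_apply_apply x
  refine ⟨τ p, e.symm, ?_, fun t => ?_, fun t => ?_, e.symm.surjective⟩
  · have := hmono hp
    simpa [τ] using this
  · have := (hτ (e.symm t)).of_local_left_inverse e.symm.continuous.continuousAt
      (inv_pos.mpr (hpos _)).ne' (Eventually.of_forall he)
    simpa using this
  · apply e.injective
    change τ _ = τ _
    rw [he]
    have h := hperi.intervalIntegral_add_eq_add 0 (e.symm t) hii
    change τ (e.symm t + p) = τ (e.symm t) + _ at h
    rw [h, he, zero_add]

theorem tendsto_div_atTop_zero_of_bounded {f : ℝ → ℝ} {C : ℝ} (hf : ∀ t, |f t| ≤ C) :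
    Tendsto (fun t => f t / t) atTop (𝓝 0) := by
  have h : Tendsto (fun t : ℝ => C / |t|) atTop (𝓝 0) :=
    tendsto_const_nhds.div_atTop tendsto_abs_atTop_atTop
  refine squeeze_zero_norm (fun t => ?_) h
  rw [Real.norm_eq_abs, abs_div]
  gcongr
  exact hf t

theorem Continuous.exists_abs_le_of_periodic {f : ℝ → ℝ} {T : ℝ} (hf : Continuous f) (hT : T ≠ 0)
    (hper : Function.Periodic f T) : ∃ C, ∀ t, |f t| ≤ C := by
  obtain ⟨C, hC⟩ := (hper.isBounded_of_continuous hT hf).exists_norm_le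
  exact ⟨C, fun t => hC _ ⟨t, rfl⟩⟩

/-- A function that gains `p` per period `T` has rotation number `p / T`. -/
theorem tendsto_div_atTop_of_add_period {s : ℝ → ℝ} {T p : ℝ} (hs : Continuous s) (hT : T ≠ 0)
    (hper : ∀ t, s (t + T) = s t + p) : Tendsto (fun t => s t / t) atTop (𝓝 (p / T)) := by
  obtain ⟨C, hC⟩ := Continuous.exists_abs_le_of_periodic (f := fun t => s t - p / T * t) (T := T)
    (by fun_prop) hT (fun t => by simp only [hper]; field_simp; ring)
  have h := (tendsto_div_atTop_zero_of_bounded hC).add_const (p / T)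
  rw [zero_add] at h
  refine h.congr' ?_
  filter_upwards [eventually_gt_atTop 0] with t ht
  field_simp
  ring

end ScalarFlow

/-! ### Differential inequalities -/

section Decay

/-- A nonnegative quantity that decays exponentially as long as it is below a threshold stays
below it and decays for all time. -/
theorem le_exp_decay_of_deriv_le {V V' : ℝ → ℝ} {b c : ℝ} (hc : 0 < c)
    (hV : ∀ t, HasDerivAt V (V' t) t) (hdec : ∀ t, V t < b → V' t ≤ -c * V t)
    (hnn : ∀ t, 0 ≤ V t) (h0 : V 0 < b) {t : ℝ} (ht : 0 ≤ t) :
    V t ≤ V 0 * Real.exp (-(c / 2) * t) := by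
  -- Barrier argument: where `V` first touches the barrier, `V' ≤ -c V < -(c/2) V`. The halved rate
  -- makes this strict, and `η` keeps the barrier positive even if `V 0 = 0`.
  have key : ∀ η > 0, V 0 + η < b → V t ≤ (V 0 + η) * Real.exp (-(c / 2) * t) := by
    intro η hη hb
    have hpos : 0 < V 0 + η := by linarith [hnn 0]
    refine image_le_of_deriv_right_lt_deriv_boundary (f := V) (f' := V') (a := 0) (b := t)
      (B := fun t => (V 0 + η) * Real.exp (-(c / 2) * t))
      (B' := fun t => (V 0 + η) * (Real.exp (-(c / 2) * t) * (-(c / 2))))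
      (fun x _ => (hV x).continuousAt.continuousWithinAt) (fun x _ => (hV x).hasDerivWithinAt)
      (by simp [hη.le]) (fun x => ?_) (fun x hx hVx => ?_) ⟨ht, le_rfl⟩
    · have := ((hasDerivAt_id x).const_mul (-(c / 2))).exp.const_mul (V 0 + η)
      simpa using this
    · have hle : Real.exp (-(c / 2) * x) ≤ 1 :=
        Real.exp_le_one_iff.mpr (by nlinarith [hx.1])
      have hVb : V x < b := by rw [hVx]; nlinarith
      have hVp : 0 < V x := by rw [hVx]; positivity
      have := hdec x hVb
      calc V' x ≤ -c * V x := this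
        _ < -(c / 2) * V x := by nlinarith
        _ = _ := by rw [hVx]; ring
  have hlim : Tendsto (fun η => (V 0 + η) * Real.exp (-(c / 2) * t)) (𝓝[>] 0)
      (𝓝 ((V 0 + 0) * Real.exp (-(c / 2) * t))) :=
    ((by fun_prop : Continuous fun η : ℝ => (V 0 + η) * Real.exp (-(c / 2) * t)).tendsto
      0).mono_left nhdsWithin_le_nhds
  rw [add_zero] at hlim
  refine ge_of_tendsto hlim ?_
  filter_upwards [Ioo_mem_nhdsGT (sub_pos.mpr h0)] with η hη
  exact key η hη.1 (by linarith [hη.2])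

/-- A bounded nonnegative quantity that decays exponentially along a full orbit vanishes. -/
theorem eq_zero_of_deriv_le_of_bounded {V V' : ℝ → ℝ} {b c : ℝ} (hc : 0 < c)
    (hV : ∀ t, HasDerivAt V (V' t) t) (hdec : ∀ t, V' t ≤ -c * V t)
    (hnn : ∀ t, 0 ≤ V t) (hb : ∀ t, V t ≤ b) : V 0 = 0 := by
  have hd : ∀ t, HasDerivAt (fun t => V t * Real.exp (c * t))
      (V' t * Real.exp (c * t) + V t * (Real.exp (c * t) * c)) t := fun t => by
    have := (hV t).fun_mul ((hasDerivAt_id t).const_mul c).exp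
    simpa using this
  -- Comparing time `0` with time `-t` gives `V 0 ≤ b exp(-c t)` for all `t ≥ 0`.
  have hanti : Antitone fun t => V t * Real.exp (c * t) :=
    antitone_of_deriv_nonpos (fun t => (hd t).differentiableAt) fun t => by
      rw [(hd t).deriv]
      nlinarith [hdec t, Real.exp_pos (c * t)]
  have hle : ∀ t : ℝ, 0 ≤ t → V 0 ≤ b * Real.exp (-(c * t)) := fun t ht => by
    have h := hanti (neg_nonpos.mpr ht)
    simp only [mul_zero, Real.exp_zero, mul_one, mul_neg] at h
    exact h.trans (by gcongr; exact hb _)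
  have hlim : Tendsto (fun t : ℝ => b * Real.exp (-(c * t))) atTop (𝓝 (b * 0)) :=
    (Real.tendsto_exp_neg_atTop_nhds_zero.comp (tendsto_id.const_mul_atTop hc)).const_mul b
  rw [mul_zero] at hlim
  refine le_antisymm (ge_of_tendsto hlim ?_) (hnn 0)
  filter_upwards [eventually_ge_atTop 0] with t ht using hle t ht

end Decay

/-! ### Lifts that stay near a lattice -/

section Lifts

/-- A continuous real lift that stays, modulo `p`, within `δ < p / 2` of the origin, stays near one
and the same multiple of `p`. -/
theorem forall_abs_sub_lt_of_continuous {x : ℝ → ℝ} {p δ : ℝ} (hx : Continuous x) (hδ : 2 * δ < p)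
    (h0 : |x 0| < δ) (h : ∀ t, ∃ n : ℤ, |x t - n * p| < δ) (t : ℝ) : |x t| < δ := by
  by_contra! hge
  have hmem : δ ∈ Set.uIcc |x 0| |x t| := Set.mem_uIcc_of_le h0.le hge
  obtain ⟨s, -, hs⟩ := intermediate_value_uIcc (f := fun s => |x s|) (hx.abs.continuousOn) hmem
  obtain ⟨n, hn⟩ := h s
  have hδ0 : 0 < δ := (abs_nonneg _).trans_lt h0
  simp only at hs
  rcases eq_or_ne n 0 with rfl | hne
  · simp at hn; linarith
  · have h1 : (1 : ℝ) ≤ |(n : ℝ)| := by exact_mod_cast Int.one_le_abs hne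
    have h2 : |(n : ℝ) * p| ≤ |x s| + |x s - n * p| := by
      have := abs_sub_abs_le_abs_sub (n * p : ℝ) (x s)
      rw [abs_sub_comm] at this; linarith
    rw [abs_mul, abs_of_pos (by linarith : 0 < p)] at h2
    nlinarith

end Lifts

/-! ### Periodic solutions of contracting scalar equations -/

section PeriodicSolution

/-- The solution of `v' = -a v + G` that is periodic with the period `p` of `G`. -/
noncomputable def periodicResponse (a p : ℝ) (G : ℝ → ℝ) (s : ℝ) : ℝ :=
  (1 - Real.exp (-(a * p)))⁻¹ * (Real.exp (-(a * s)) * ∫ τ in (s - p)..s, Real.exp (a * τ) * G τ)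

variable {a p : ℝ} {G H : ℝ → ℝ}

/-- The response is the convolution of `G` with the kernel `exp(-a t)` over the whole past.
Periodicity of `G` folds this into a geometric series over one period, which is where the factor `(1
- exp(-a p))⁻¹` comes from. -/
theorem hasDerivAt_periodicResponse (ha : 0 < a) (hp : 0 < p) (hG : Continuous G)
    (hper : Function.Periodic G p) (s : ℝ) :
    HasDerivAt (periodicResponse a p G) (-a * periodicResponse a p G s + G s) s := by
  have hc : Continuous fun τ => Real.exp (a * τ) * G τ := by fun_prop
  have hD : ∀ x, HasDerivAt (fun x => ∫ τ in (0 : ℝ)..x, Real.exp (a * τ) * G τ)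
      (Real.exp (a * x) * G x) x := fun x =>
    intervalIntegral.integral_hasDerivAt_right (hc.intervalIntegrable _ _)
      (hc.stronglyMeasurableAtFilter _ _) hc.continuousAt
  have hI : HasDerivAt (fun s => ∫ τ in (s - p)..s, Real.exp (a * τ) * G τ)
      (Real.exp (a * s) * G s - Real.exp (a * (s - p)) * G (s - p)) s := by
    have h := (hD s).sub ((hD (s - p)).comp_sub_const s p)
    refine h.congr_of_eventuallyEq (Eventually.of_forall fun x => ?_)
    simp only [Pi.sub_apply]
    rw [intervalIntegral.integral_interval_sub_left] <;> exact hc.intervalIntegrable _ _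
  have he : HasDerivAt (fun s : ℝ => Real.exp (-(a * s))) (Real.exp (-(a * s)) * (-a)) s := by
    have := ((hasDerivAt_id s).const_mul a).neg.exp
    simpa using this
  have hlt : Real.exp (-(a * p)) < 1 := by
    rw [← Real.exp_zero]; exact Real.exp_lt_exp.mpr (neg_lt_zero.mpr (mul_pos ha hp))
  have h1 : (1 - Real.exp (-(a * p))) ≠ 0 := by linarith
  refine ((he.fun_mul hI).const_mul (1 - Real.exp (-(a * p)))⁻¹).congr_deriv ?_
  have hGp : G (s - p) = G s := by simpa using (hper (s - p)).symm
  have e1 : Real.exp (-(a * s)) * Real.exp (a * s) = 1 := by rw [← Real.exp_add]; simp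
  have e2 : Real.exp (-(a * s)) * Real.exp (a * (s - p)) = Real.exp (-(a * p)) := by
    rw [← Real.exp_add]; congr 1; ring
  unfold periodicResponse
  rw [hGp]
  have : Real.exp (-(a * s)) * (Real.exp (a * s) * G s - Real.exp (a * (s - p)) * G s) =
      (1 - Real.exp (-(a * p))) * G s := by linear_combination G s * e1 - G s * e2
  rw [this, mul_add, ← mul_assoc _ (1 - Real.exp (-(a * p))) (G s), inv_mul_cancel₀ h1]
  ring

theorem periodicResponse_periodic (hper : Function.Periodic G p) :
    Function.Periodic (periodicResponse a p G) p := fun s => by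
  unfold periodicResponse
  congr 1
  have h := intervalIntegral.integral_comp_add_right (a := s - p) (b := s)
    (fun τ => Real.exp (a * τ) * G τ) p
  rw [sub_add_cancel] at h
  rw [add_sub_cancel_right, ← h]
  simp only [hper _, mul_add, Real.exp_add, neg_add]
  simp_rw [mul_right_comm _ (Real.exp (a * p)) _]
  rw [intervalIntegral.integral_mul_const]
  have : Real.exp (-(a * p)) * Real.exp (a * p) = 1 := by rw [← Real.exp_add]; simp
  linear_combination (Real.exp (-(a * s)) * ∫ x in s - p..s, Real.exp (a * x) * G x) * this

/-- The kernel `exp(-a t)` on `t ≥ 0` has total mass `1 / a`. -/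
theorem abs_periodicResponse_le (ha : 0 < a) (hp : 0 < p) {B : ℝ} (hB : ∀ s, |G s| ≤ B) (s : ℝ) :
    |periodicResponse a p G s| ≤ B / a := by
  have hlt : Real.exp (-(a * p)) < 1 := by
    rw [← Real.exp_zero]; exact Real.exp_lt_exp.mpr (neg_lt_zero.mpr (mul_pos ha hp))
  have h1 : 0 < 1 - Real.exp (-(a * p)) := by linarith
  have hint : |∫ τ in (s - p)..s, Real.exp (a * τ) * G τ| ≤
      ∫ τ in (s - p)..s, Real.exp (a * τ) * B := by
    have hcB : Continuous fun τ => Real.exp (a * τ) * B := by fun_prop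
    rw [← Real.norm_eq_abs]
    refine intervalIntegral.norm_integral_le_of_norm_le (by linarith)
      (Eventually.of_forall fun τ _ => ?_) (hcB.intervalIntegrable _ _)
    rw [norm_mul, Real.norm_of_nonneg (Real.exp_pos _).le]
    gcongr
    exact hB τ
  have hval : ∫ τ in (s - p)..s, Real.exp (a * τ) * B =
      (Real.exp (a * s) - Real.exp (a * (s - p))) / a * B := by
    rw [intervalIntegral.integral_mul_const, intervalIntegral.integral_comp_mul_left _ ha.ne',
      integral_exp, smul_eq_mul]
    ring
  have e1 : Real.exp (-(a * s)) * Real.exp (a * s) = 1 := by rw [← Real.exp_add]; simp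
  have e2 : Real.exp (-(a * s)) * Real.exp (a * (s - p)) = Real.exp (-(a * p)) := by
    rw [← Real.exp_add]; congr 1; ring
  unfold periodicResponse
  rw [abs_mul, abs_mul, abs_of_pos (inv_pos.mpr h1), abs_of_pos (Real.exp_pos _)]
  calc _ ≤ (1 - Real.exp (-(a * p)))⁻¹ * (Real.exp (-(a * s)) *
        ((Real.exp (a * s) - Real.exp (a * (s - p))) / a * B)) := by
        rw [← hval]; gcongr
    _ = (1 - Real.exp (-(a * p)))⁻¹ * ((1 - Real.exp (-(a * p))) * (B / a)) := by
        congr 1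
        linear_combination (B / a) * e1 - (B / a) * e2
    _ = B / a := by rw [← mul_assoc, inv_mul_cancel₀ h1.ne', one_mul]

theorem periodicResponse_sub (hG : Continuous G) (hH : Continuous H) (s : ℝ) :
    periodicResponse a p G s - periodicResponse a p H s =
      periodicResponse a p (fun s => G s - H s) s := by
  unfold periodicResponse
  simp only [mul_sub]
  rw [intervalIntegral.integral_sub (Continuous.intervalIntegrable (by fun_prop) _ _)
    (Continuous.intervalIntegrable (by fun_prop) _ _)]
  ring

/-- A scalar time-periodic equation `u' = F(u, s)` that contracts the strip `|u| ≤ δ` has a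
periodic solution in this strip. -/
theorem exists_periodic_solution {F : ℝ → ℝ → ℝ} {p c M δ C : ℝ} (hp : 0 < p) (hc : 0 < c)
    (hδ : 0 < δ) (hC : C ≤ c * δ)
    (hcont : ContinuousOn (Function.uncurry F) (Set.Icc (-δ) δ ×ˢ Set.univ))
    (hper : ∀ u, Function.Periodic (F u) p)
    (hcontr : ∀ u v s, |u| ≤ δ → |v| ≤ δ → (F u s - F v s) * (u - v) ≤ -c * (u - v) ^ 2)
    (hlip : ∀ u v s, |u| ≤ δ → |v| ≤ δ → |F u s - F v s| ≤ M * |u - v|)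
    (hC0 : ∀ s, |F 0 s| ≤ C) :
    ∃ u : ℝ → ℝ, Function.Periodic u p ∧ (∀ s, |u s| ≤ C / c) ∧
      ∀ s, HasDerivAt u (F (u s) s) s := by
  -- The difference quotients of `F` in `u` lie in `[-M, -c]`. Adding `a u` with `a ≥ M` moves them
  -- into `[0, a - c]`, so `F + a u` is Lipschitz with a constant less than `a`.
  obtain ⟨a, hac, haM⟩ : ∃ a, c < a ∧ M ≤ a := ⟨max (c + 1) M, by simp, le_max_right _ _⟩
  have ha : 0 < a := hc.trans hac
  have hdiff : ∀ u v s, |u| ≤ δ → |v| ≤ δ →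
      |(F u s + a * u) - (F v s + a * v)| ≤ (a - c) * |u - v| := by
    intro u v s hu hv
    have h1 := hcontr u v s hu hv
    have h2 := abs_le.mp (hlip u v s hu hv)
    rcases lt_trichotomy (u - v) 0 with h | h | h
    · rw [abs_of_neg h] at h2 ⊢
      have h3 : -c * (u - v) ≤ F u s - F v s := by nlinarith
      exact abs_le.mpr ⟨by nlinarith, by nlinarith⟩
    · have : u = v := by linarith
      subst this; simp
    · rw [abs_of_pos h] at h2 ⊢
      have h3 : F u s - F v s ≤ -c * (u - v) := by nlinarith
      exact abs_le.mpr ⟨by nlinarith, by nlinarith⟩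
  let Z : Set (BoundedContinuousFunction ℝ ℝ) :=
    {u | (∀ s, u (s + p) = u s) ∧ ∀ s, |u s| ≤ δ}
  have hZc : IsClosed Z := by
    have e : Z = (⋂ s : ℝ, {u | u (s + p) = u s}) ∩ ⋂ s : ℝ, {u | |u s| ≤ δ} := by
      ext u; simp [Z]
    rw [e]
    exact (isClosed_iInter fun s => isClosed_eq (continuous_eval_const _)
      (continuous_eval_const _)).inter
      (isClosed_iInter fun s =>
        isClosed_le (continuous_eval_const _).abs continuous_const)
  have : CompleteSpace Z := hZc.completeSpace_coe
  have : Nonempty Z := ⟨⟨0, by simp [Z, hδ.le]⟩⟩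
  let N : Z → ℝ → ℝ := fun u s => F (u.1 s) s + a * u.1 s
  have hNc : ∀ u : Z, Continuous (N u) := fun u => by
    have h : Continuous fun s => Function.uncurry F (u.1 s, s) :=
      hcont.comp_continuous (by fun_prop) fun s => ⟨abs_le.mp (u.2.2 s), trivial⟩
    exact h.add (by fun_prop)
  have hNper : ∀ u : Z, Function.Periodic (N u) p := fun u s => by
    simp only [N, u.2.1 s, hper _ s]
  have hNb : ∀ (u : Z) (b : ℝ), (∀ s, |u.1 s| ≤ b) → ∀ s, |N u s| ≤ (a - c) * b + C := by
    intro u b hb s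
    have h1 := hdiff (u.1 s) 0 s (u.2.2 s) (by simp [hδ.le])
    have h2 : |N u s| ≤ |(F (u.1 s) s + a * u.1 s) - (F 0 s + a * 0)| + |F 0 s| := by
      have := abs_add_le ((F (u.1 s) s + a * u.1 s) - (F 0 s + a * 0)) (F 0 s)
      simpa [N] using this
    rw [sub_zero] at h1
    have h3 := mul_le_mul_of_nonneg_left (hb s) (sub_pos.mpr hac).le
    linarith [hC0 s]
  have hderiv : ∀ (u : Z) s, HasDerivAt (periodicResponse a p (N u))
      (-a * periodicResponse a p (N u) s + N u s) s := fun u s =>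
    hasDerivAt_periodicResponse ha hp (hNc u) (hNper u) s
  have hΦb : ∀ (u : Z) s, |periodicResponse a p (N u) s| ≤ δ := fun u s => by
    refine (abs_periodicResponse_le ha hp (hNb u δ u.2.2) s).trans ?_
    rw [div_le_iff₀ ha]; linarith
  -- A fixed point solves `u' = -a u + (F(u, s) + a u) = F(u, s)`. The response has gain `1 / a`, so
  -- `Φ` contracts with factor `(a - c) / a`; the hypothesis `C ≤ c δ` keeps the strip invariant.
  let Φ : Z → Z := fun u =>
    ⟨BoundedContinuousFunction.ofNormedAddCommGroup (periodicResponse a p (N u))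
      (continuous_iff_continuousAt.mpr fun s => (hderiv u s).continuousAt) δ (hΦb u),
      periodicResponse_periodic (hNper u), hΦb u⟩
  have hΦ : ∀ u : Z, ∀ s, (Φ u).1 s = periodicResponse a p (N u) s := fun u s => rfl
  have hq0 : 0 ≤ (a - c) / a := div_nonneg (by linarith) ha.le
  have hcw : ContractingWith (Real.toNNReal ((a - c) / a)) Φ := by
    refine ⟨?_, LipschitzWith.of_dist_le_mul fun u v => ?_⟩
    · rw [Real.toNNReal_lt_one, div_lt_one ha]; linarith
    · refine (BoundedContinuousFunction.dist_le (by positivity)).mpr fun s => ?_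
      rw [hΦ, hΦ, Real.dist_eq, periodicResponse_sub (hNc u) (hNc v)]
      refine (abs_periodicResponse_le ha hp (B := (a - c) * dist u v) (fun s => ?_) s).trans
        (le_of_eq ?_)
      · refine (hdiff _ _ s (u.2.2 s) (v.2.2 s)).trans ?_
        have : |u.1 s - v.1 s| ≤ dist u v :=
          BoundedContinuousFunction.dist_coe_le_dist (f := u.1) (g := v.1) s
        exact mul_le_mul_of_nonneg_left this (by linarith)
      · rw [Real.coe_toNNReal _ hq0]
        ring
  let u := ContractingWith.fixedPoint Φ hcw
  have hfix : Φ u = u := hcw.fixedPoint_isFixedPt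
  have hu : ∀ s, u.1 s = periodicResponse a p (N u) s := fun s => by
    rw [← hΦ, hfix]
  have hfun : (u.1 : ℝ → ℝ) = periodicResponse a p (N u) := funext hu
  refine ⟨u.1, u.2.1, fun s => ?_, fun s => ?_⟩
  · have hn : ∀ s, |u.1 s| ≤ ‖u.1‖ := fun s => u.1.norm_coe_le_norm s
    -- The fixed point inequality `a ‖u‖ ≤ (a - c) ‖u‖ + C` improves the a priori bound `δ` to `C /
    -- c`.
    have h1 : ‖u.1‖ ≤ ((a - c) * ‖u.1‖ + C) / a := by
      refine (BoundedContinuousFunction.norm_le ?_).mpr fun s => ?_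
      · have := (abs_nonneg _).trans (hNb u _ hn 0)
        positivity
      · rw [hu s]
        exact abs_periodicResponse_le ha hp (hNb u _ hn) s
    rw [le_div_iff₀ ha] at h1
    refine (hn s).trans ?_
    rw [le_div_iff₀ hc]
    linarith
  · have := hderiv u s
    rw [← hfun] at this
    refine this.congr_deriv ?_
    simp only [N]; ring

end PeriodicSolution

/-! ### Uniform estimates for the phase differences -/

section PhaseRates

/-- The rate of change of `x = θ₁ - θ₃` as a function of the phase differences
`x = θ₁ - θ₃`, `y = θ₂ - θ₄`, `z = θ₁ - θ₂`. -/
noncomputable def phaseRate₁ (g : ℝ → ℝ) (ε x y z : ℝ) : ℝ :=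
  g x - g (-x) + ε * (g z - g (z - x) + (g (z + y) - g (z + y - x)))

/-- The rate of change of `y = θ₂ - θ₄`. -/
noncomputable def phaseRate₂ (g : ℝ → ℝ) (ε x y z : ℝ) : ℝ :=
  g y - g (-y) + ε * (g (x - z) + g (-z) - g (-z - y) - g (x - z - y))

/-- The rate of change of `z = θ₁ - θ₂`. -/
noncomputable def phaseRate₃ (g : ℝ → ℝ) (ε x y z : ℝ) : ℝ :=
  g x - g y + ε * (g z + g (z + y) - g (-z) - g (x - z))

/-- In the strip `|x|, |y - π| ≤ δ` the phase differences `x` and `y` contract with rate `c`, while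
`σ z` increases with a speed between `κ` and `3 κ`. -/
structure ContractionBounds (g : ℝ → ℝ) (ε σ c κ δ Λ η : ℝ) : Prop where
  sign_sq : σ * σ = 1
  rate_pos : 0 < c
  speed_pos : 0 < κ
  width_pos : 0 < δ
  contract₁ : ∀ x y z, |x| ≤ δ → x * phaseRate₁ g ε x y z ≤ -c * x ^ 2
  contract₂ : ∀ u v z, |u| ≤ δ → |v| ≤ δ →
    (phaseRate₂ g ε 0 (Real.pi + u) z - phaseRate₂ g ε 0 (Real.pi + v) z) * (u - v) ≤
      -c * (u - v) ^ 2
  lipschitz₂ : ∀ u v z,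
    |phaseRate₂ g ε 0 (Real.pi + u) z - phaseRate₂ g ε 0 (Real.pi + v) z| ≤ Λ * |u - v|
  cross₂ : ∀ x y z, |phaseRate₂ g ε x y z - phaseRate₂ g ε 0 y z| ≤ c / 8 * |x|
  small₂ : ∀ u z, |u| ≤ δ → |phaseRate₂ g ε 0 (Real.pi + u) z| ≤ η
  center₂ : ∀ z, |phaseRate₂ g ε 0 Real.pi z| ≤ Λ * |ε|
  speed_ge : ∀ u z, |u| ≤ δ → κ ≤ σ * phaseRate₃ g ε 0 (Real.pi + u) z
  speed_le : ∀ u z, |u| ≤ δ → σ * phaseRate₃ g ε 0 (Real.pi + u) z ≤ 3 * κ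
  lipschitz₃ : ∀ x u v z,
    |phaseRate₃ g ε x (Real.pi + u) z - phaseRate₃ g ε 0 (Real.pi + v) z| ≤ Λ * (|x| + |u - v|)
  small_slope : η * Λ ≤ c * κ / 8
  small_coupling : 12 * (Λ * |ε|) ≤ c * δ

/-- Strict differentiability controls difference quotients of two moving points, which the
contraction between arbitrary `u` and `v` requires. -/
theorem HasStrictDerivAt.exists_contraction {H : ℝ → ℝ} {a m : ℝ} (hm : 0 < m)
    (hH : HasStrictDerivAt H (-m) a) :
    ∃ δ > 0, ∀ u v, |u| ≤ δ → |v| ≤ δ →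
      (H (a + u) - H (a + v)) * (u - v) ≤ -(m / 2) * (u - v) ^ 2 := by
  have h := hH.isLittleO.def (half_pos hm)
  obtain ⟨δ, hδ, hball⟩ := Metric.eventually_nhds_iff_ball.mp h
  refine ⟨δ / 2, half_pos hδ, fun u v hu hv => ?_⟩
  have hmem : (a + u, a + v) ∈ Metric.ball (a, a) δ := by
    rw [Metric.mem_ball, Prod.dist_eq, max_lt_iff]
    simp only [Real.dist_eq, add_sub_cancel_left]
    constructor <;> linarith
  have h2 := hball _ hmem
  simp only [add_sub_add_left_eq_sub, Real.norm_eq_abs,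
    ContinuousLinearMap.toSpanSingleton_apply, smul_eq_mul] at h2
  have h3 : (H (a + u) - H (a + v) - (u - v) * -m) * (u - v) ≤ m / 2 * (u - v) ^ 2 := by
    refine (le_abs_self _).trans ?_
    rw [abs_mul, ← sq_abs (u - v), sq, ← mul_assoc]
    exact mul_le_mul_of_nonneg_right h2 (abs_nonneg _)
  nlinarith

theorem eventually_mul_le (K : ℝ) {b : ℝ} (hb : 0 < b) : ∀ᶠ d in 𝓝[>] (0 : ℝ), K * d ≤ b := by
  have h : Tendsto (fun d : ℝ => K * d) (𝓝[>] 0) (𝓝 (K * 0)) :=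
    ((by fun_prop : Continuous fun d : ℝ => K * d).tendsto 0).mono_left nhdsWithin_le_nhds
  rw [mul_zero] at h
  filter_upwards [h.eventually_lt_const hb] with d hd using hd.le

-- The constants are fixed in the order `c`, `δ`, `ε₀`. First `c` comes from the linear rates at `ε
-- = 0`. Then `δ` makes the drift of `y` in the strip small against `c κ`, and finally `ε₀` makes
-- the coupling negligible at the scale `δ`.
set_option maxHeartbeats 1000000 in
theorem exists_contractionBounds {g : ℝ → ℝ} {L σ κ m₁ m₂ : ℝ}
    (hL : ∀ a b, |g a - g b| ≤ L * |a - b|) (hb : ∀ a, |g a| ≤ L) (hL0 : 0 < L)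
    (hper : Function.Periodic g (2 * Real.pi)) (hσ : σ * σ = 1) (hκ : 0 < κ)
    (hg : σ * (g 0 - g Real.pi) = 2 * κ) (hm₁ : 0 < m₁) (hm₂ : 0 < m₂)
    (h₁ : HasStrictDerivAt (fun x => g x - g (-x)) (-m₁) 0)
    (h₂ : HasStrictDerivAt (fun x => g x - g (-x)) (-m₂) Real.pi) :
    ∃ c δ Λ η ε₀ : ℝ, δ ≤ 1 ∧ 0 < ε₀ ∧
      ∀ ε, |ε| < ε₀ → ContractionBounds g ε σ c κ δ Λ η := by
  obtain ⟨d₁, hd₁, hc₁⟩ := h₁.exists_contraction hm₁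
  obtain ⟨d₂, hd₂, hc₂⟩ := h₂.exists_contraction hm₂
  -- The uncoupled contraction rates are at least `2 c`; the coupling may consume one `c`.
  obtain ⟨c, hc, hcm₁, hcm₂⟩ : ∃ c > 0, 2 * c ≤ m₁ / 2 ∧ 2 * c ≤ m₂ / 2 :=
    ⟨min m₁ m₂ / 4, by positivity, by linarith [min_le_left m₁ m₂],
      by linarith [min_le_right m₁ m₂]⟩
  have hck : 0 < c * κ := mul_pos hc hκ
  -- The bound `5 L δ ≤ κ` keeps the speed within `κ` of `2 κ`, and the last one is `small_slope`
  -- for `η = 6 L δ`, `Λ = 4 L`.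
  obtain ⟨δ, hδ, hδ1, hδd₁, hδd₂, hδL, hδc⟩ : ∃ δ : ℝ, 0 < δ ∧ 1 * δ ≤ 1 ∧ 1 * δ ≤ d₁ ∧ 1 * δ ≤ d₂ ∧
      (5 * L) * δ ≤ κ ∧ (6 * L * (4 * L) * 8) * δ ≤ c * κ :=
    (eventually_mem_nhdsWithin.and ((eventually_mul_le _ one_pos).and
      ((eventually_mul_le _ hd₁).and ((eventually_mul_le _ hd₂).and
      ((eventually_mul_le _ hκ).and (eventually_mul_le _ hck)))))).exists
  rw [one_mul] at hδ1 hδd₁ hδd₂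
  have hcd : 0 < c * δ := mul_pos hc hδ
  -- These bounds absorb the coupling into multiples of `δ`, into `cross₂` and the contraction
  -- rates, and into `small_coupling`, respectively.
  obtain ⟨ε₀, hε₀, hεδ, hεL, hεc⟩ : ∃ ε₀ : ℝ, 0 < ε₀ ∧ 1 * ε₀ ≤ δ ∧ (16 * L) * ε₀ ≤ c ∧
      (12 * (4 * L)) * ε₀ ≤ c * δ :=
    (eventually_mem_nhdsWithin.and ((eventually_mul_le _ hδ).and ((eventually_mul_le _ hc).and
      (eventually_mul_le _ hcd)))).exists
  rw [one_mul] at hεδ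
  refine ⟨c, δ, 4 * L, 6 * L * δ, ε₀, hδ1, hε₀, fun ε hε => ?_⟩
  have he0 := abs_nonneg ε
  have he1 : |ε| ≤ 1 := by linarith
  have heL : 16 * L * |ε| ≤ c := by nlinarith
  have hcL : 2 * (L * |ε|) ≤ c := by nlinarith
  have heδ : |ε| * L ≤ L * δ := by nlinarith
  have hgπ : g Real.pi - g (-Real.pi) = 0 := by
    have := hper (-Real.pi)
    rw [show -Real.pi + 2 * Real.pi = Real.pi by ring] at this
    linarith
  have h2L : ∀ a b a' b', |g a - g b + (g a' - g b')| ≤ L * |a - b| + L * |a' - b'| :=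
    fun a b a' b' => (abs_add_le _ _).trans (add_le_add (hL _ _) (hL _ _))
  have h4 : ∀ a b a' b', |g a + g b - g a' - g b'| ≤ 4 * L := fun a b a' b' => by
    have := abs_le.mp (hb a); have := abs_le.mp (hb b)
    have := abs_le.mp (hb a'); have := abs_le.mp (hb b')
    exact abs_le.mpr ⟨by linarith, by linarith⟩
  have hεmul : ∀ A B : ℝ, |A| ≤ B → |ε * A| ≤ |ε| * B := fun A B h => by
    rw [abs_mul]; exact mul_le_mul_of_nonneg_left h he0
  have hd2 : ∀ u v z, |ε * (g (0 - z) + g (-z) - g (-z - (Real.pi + u)) - g (0 - z - (Real.pi + u)))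
      - ε * (g (0 - z) + g (-z) - g (-z - (Real.pi + v)) - g (0 - z - (Real.pi + v)))| ≤
      |ε| * (2 * L * |u - v|) := fun u v z => by
    rw [← mul_sub]
    refine hεmul _ _ ?_
    have := h2L (-z - (Real.pi + v)) (-z - (Real.pi + u)) (0 - z - (Real.pi + v))
      (0 - z - (Real.pi + u))
    rw [show -z - (Real.pi + v) - (-z - (Real.pi + u)) = u - v by ring,
      show 0 - z - (Real.pi + v) - (0 - z - (Real.pi + u)) = u - v by ring] at this
    refine le_trans (le_of_eq ?_) (this.trans (le_of_eq ?_))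
    · congr 1; ring
    · ring
  have hspeed : ∀ u z, |u| ≤ δ → |σ * phaseRate₃ g ε 0 (Real.pi + u) z - 2 * κ| ≤ κ := by
    intro u z hu
    have hσ1 : |σ| = 1 := by
      have : |σ| * |σ| = 1 := by rw [← abs_mul, hσ, abs_one]
      nlinarith [abs_nonneg σ]
    rw [← hg, ← mul_sub, abs_mul, hσ1, one_mul]
    have e1 := hL Real.pi (Real.pi + u)
    rw [sub_add_cancel_left, abs_neg] at e1
    have e2 := hεmul _ _ (h4 z (z + (Real.pi + u)) (-z) (0 - z))
    have e3 : L * |u| ≤ L * δ := by gcongr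
    have e4 : phaseRate₃ g ε 0 (Real.pi + u) z - (g 0 - g Real.pi) = (g Real.pi - g (Real.pi + u)) +
        ε * (g z + g (z + (Real.pi + u)) - g (-z) - g (0 - z)) := by
      unfold phaseRate₃; ring
    rw [e4]
    refine (abs_add_le _ _).trans ?_
    linarith
  refine ⟨hσ, hc, hκ, hδ, ?_, ?_, ?_, ?_, ?_, ?_, ?_, ?_, ?_, ?_, ?_⟩
  · intro x y z hx
    have e1 := hc₁ x 0 (hx.trans hδd₁) (by simp [hd₁.le])
    simp only [zero_add, sub_zero, neg_zero, sub_self] at e1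
    have e2 := hεmul _ _ (h2L z (z - x) (z + y) (z + y - x))
    rw [sub_sub_cancel, sub_sub_cancel] at e2
    have e3 : x * (ε * (g z - g (z - x) + (g (z + y) - g (z + y - x)))) ≤
        |x| * (|ε| * (L * |x| + L * |x|)) := by
      refine (le_abs_self _).trans ?_
      rw [abs_mul]
      gcongr
    have e4 : |x| * (|ε| * (L * |x| + L * |x|)) = 2 * (L * |ε|) * x ^ 2 := by
      rw [← sq_abs x]; ring
    have e5 := sq_nonneg x
    unfold phaseRate₁
    rw [mul_add]
    have e6 : 2 * (L * |ε|) * x ^ 2 ≤ c * x ^ 2 :=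
      mul_le_mul_of_nonneg_right hcL e5
    have e7 : -(m₁ / 2) * x ^ 2 ≤ -(2 * c) * x ^ 2 :=
      mul_le_mul_of_nonneg_right (by linarith) e5
    linarith [mul_comm (g x - g (-x)) x]
  · intro u v z hu hv
    have e1 := hc₂ u v (hu.trans hδd₂) (hv.trans hδd₂)
    have e2 := mul_le_mul_of_nonneg_right (hd2 u v z) (abs_nonneg (u - v))
    rw [← abs_mul] at e2
    have e3 := (le_abs_self _).trans e2
    have e4 : |ε| * (2 * L * |u - v|) * |u - v| = 2 * (L * |ε|) * (u - v) ^ 2 := by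
      rw [← sq_abs (u - v)]; ring
    have e6 : 2 * (L * |ε|) * (u - v) ^ 2 ≤ c * (u - v) ^ 2 :=
      mul_le_mul_of_nonneg_right hcL (sq_nonneg _)
    have e7 : -(m₂ / 2) * (u - v) ^ 2 ≤ -(2 * c) * (u - v) ^ 2 :=
      mul_le_mul_of_nonneg_right (by linarith) (sq_nonneg _)
    unfold phaseRate₂
    linarith
  · intro u v z
    have e1 := h2L (Real.pi + u) (Real.pi + v) (-(Real.pi + v)) (-(Real.pi + u))
    rw [show Real.pi + u - (Real.pi + v) = u - v by ring,
      show -(Real.pi + v) - -(Real.pi + u) = u - v by ring] at e1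
    have e2 := hd2 u v z
    have e3 : |ε| * (2 * L * |u - v|) ≤ 1 * (2 * L * |u - v|) := by gcongr
    have e4 := abs_add_le _ _ |>.trans (add_le_add e1 e2)
    refine le_trans (le_of_eq ?_) (e4.trans (by linarith))
    unfold phaseRate₂
    congr 1; ring
  · intro x y z
    have e1 := hεmul _ _ (h2L (x - z) (0 - z) (0 - z - y) (x - z - y))
    rw [show x - z - (0 - z) = x by ring, show 0 - z - y - (x - z - y) = -x by ring, abs_neg] at e1
    have e2 : phaseRate₂ g ε x y z - phaseRate₂ g ε 0 y z =
        ε * (g (x - z) - g (0 - z) + (g (0 - z - y) - g (x - z - y))) := by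
      unfold phaseRate₂; ring
    rw [e2]
    refine e1.trans ?_
    have := mul_le_mul_of_nonneg_right heL (abs_nonneg x)
    linarith
  · intro u z hu
    have e1 := h2L (Real.pi + u) Real.pi (-Real.pi) (-(Real.pi + u))
    rw [show Real.pi + u - Real.pi = u by ring, show -Real.pi - -(Real.pi + u) = u by ring] at e1
    have e2 := hεmul _ _ (h4 (0 - z) (-z) (-z - (Real.pi + u)) (0 - z - (Real.pi + u)))
    have e3 := abs_add_le _ _ |>.trans (add_le_add e1 e2)
    have e4 : L * |u| ≤ L * δ := by gcongr
    refine le_trans (le_of_eq ?_) (e3.trans (by linarith))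
    unfold phaseRate₂
    congr 1; linarith
  · intro z
    have e2 := hεmul _ _ (h4 (0 - z) (-z) (-z - Real.pi) (0 - z - Real.pi))
    unfold phaseRate₂
    rw [hgπ, zero_add]
    linarith
  · intro u z hu
    linarith [(abs_le.mp (hspeed u z hu)).1]
  · intro u z hu
    linarith [(abs_le.mp (hspeed u z hu)).2]
  · intro x u v z
    have e1 := h2L x 0 (Real.pi + v) (Real.pi + u)
    have e2 := hεmul _ _ (h2L (z + (Real.pi + u)) (z + (Real.pi + v)) (0 - z) (x - z))
    rw [sub_zero, show Real.pi + v - (Real.pi + u) = v - u by ring, abs_sub_comm v u] at e1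
    rw [show z + (Real.pi + u) - (z + (Real.pi + v)) = u - v by ring,
      show 0 - z - (x - z) = -x by ring, abs_neg] at e2
    have e3 : |ε| * (L * |u - v| + L * |x|) ≤ 1 * (L * |u - v| + L * |x|) := by gcongr
    have e4 := abs_add_le _ _ |>.trans (add_le_add e1 e2)
    refine le_trans (le_of_eq ?_) (e4.trans ?_)
    · unfold phaseRate₃; congr 1; ring
    · have := mul_nonneg hL0.le (abs_nonneg x)
      have := mul_nonneg hL0.le (abs_nonneg (u - v))
      linarith
  · linarith
  · nlinarith

end PhaseRates

/-! ### The invariant curve and its Lyapunov function -/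

section InvariantCurve

variable {g : ℝ → ℝ} {ε σ c κ δ Λ η : ℝ}

theorem phaseRate₂_periodic (hper : Function.Periodic g (2 * Real.pi)) (x y : ℝ) :
    Function.Periodic (phaseRate₂ g ε x y) (2 * Real.pi) := fun z => by
  unfold phaseRate₂
  rw [show x - (z + 2 * Real.pi) = x - z - 2 * Real.pi by ring,
    show -(z + 2 * Real.pi) = -z - 2 * Real.pi by ring,
    show -z - 2 * Real.pi - y = -z - y - 2 * Real.pi by ring,
    show x - z - 2 * Real.pi - y = x - z - y - 2 * Real.pi by ring]
  simp only [hper.sub_eq]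

theorem phaseRate₃_periodic (hper : Function.Periodic g (2 * Real.pi)) (x y : ℝ) :
    Function.Periodic (phaseRate₃ g ε x y) (2 * Real.pi) := fun z => by
  unfold phaseRate₃
  rw [show x - (z + 2 * Real.pi) = x - z - 2 * Real.pi by ring,
    show -(z + 2 * Real.pi) = -z - 2 * Real.pi by ring,
    show z + 2 * Real.pi + y = z + y + 2 * Real.pi by ring, hper z, hper (z + y)]
  simp only [hper.sub_eq]

theorem Function.Periodic.comp_sign_mul {f : ℝ → ℝ} {p : ℝ} (hf : Function.Periodic f p)
    (hσ : σ * σ = 1) : Function.Periodic (fun s => f (σ * s)) p := fun s => by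
  rcases mul_self_eq_one_iff.mp hσ with rfl | rfl
  · simpa using hf s
  · have := hf.sub_eq (-s)
    simp only [neg_one_mul, neg_add, ← sub_eq_add_neg, this]

/-- The slope of the trajectories in the plane `x = 0`, with `s = σ z` as independent variable and
`u = y - π` as dependent variable. -/
noncomputable def phaseSlope (g : ℝ → ℝ) (ε σ u s : ℝ) : ℝ :=
  phaseRate₂ g ε 0 (Real.pi + u) (σ * s) / (σ * phaseRate₃ g ε 0 (Real.pi + u) (σ * s))

/-- The curve `x = 0`, `y = π + P (σ z)` is invariant, closed, and near `y = π`. -/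
structure IsInvariantProfile (g : ℝ → ℝ) (ε σ c δ Λ : ℝ) (P : ℝ → ℝ) : Prop where
  periodic : Function.Periodic P (2 * Real.pi)
  abs_le : ∀ s, |P s| ≤ 6 * (Λ * |ε|) / c
  abs_le_half : ∀ s, |P s| ≤ δ / 2
  hasDerivAt : ∀ s, HasDerivAt P (phaseSlope g ε σ (P s) s) s

theorem ContractionBounds.sign_abs (h : ContractionBounds g ε σ c κ δ Λ η) : |σ| = 1 := by
  have : |σ| * |σ| = 1 := by rw [← abs_mul, h.sign_sq, abs_one]
  nlinarith [abs_nonneg σ]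

theorem ContractionBounds.abs_phaseSlope_le (h : ContractionBounds g ε σ c κ δ Λ η) {u : ℝ}
    (hu : |u| ≤ δ) (s : ℝ) : |phaseSlope g ε σ u s| ≤ η / κ := by
  have hk := h.speed_ge u (σ * s) hu
  have := h.speed_pos
  rw [phaseSlope, abs_div, abs_of_pos (h.speed_pos.trans_le hk)]
  exact div_le_div₀ ((abs_nonneg _).trans (h.small₂ u 0 hu)) (h.small₂ u _ hu) h.speed_pos hk

theorem ContractionBounds.lipschitz_nonneg (h : ContractionBounds g ε σ c κ δ Λ η) : 0 ≤ Λ := by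
  have := (abs_nonneg _).trans (h.lipschitz₂ 1 0 0)
  simpa using this

/-- Dividing by a speed that depends on `u` costs slope times the Lipschitz constant of the speed;
`small_slope` keeps this below the contraction rate. -/
theorem ContractionBounds.abs_phaseSlope_mul_le (h : ContractionBounds g ε σ c κ δ Λ η) {u : ℝ}
    (hu : |u| ≤ δ) (s : ℝ) : |phaseSlope g ε σ u s| * Λ ≤ c / 8 := by
  have h1 := mul_le_mul_of_nonneg_right (h.abs_phaseSlope_le hu s) h.lipschitz_nonneg
  have h2 : η / κ * Λ ≤ c / 8 := by
    rw [div_mul_eq_mul_div, div_le_iff₀ h.speed_pos]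
    linarith [h.small_slope]
  exact h1.trans h2

theorem ContractionBounds.abs_speed_sub_le (h : ContractionBounds g ε σ c κ δ Λ η)
    (x u v z : ℝ) :
    |σ * phaseRate₃ g ε x (Real.pi + u) z - σ * phaseRate₃ g ε 0 (Real.pi + v) z| ≤
      Λ * (|x| + |u - v|) := by
  rw [← mul_sub, abs_mul, h.sign_abs, one_mul]
  exact h.lipschitz₃ x u v z

theorem ContractionBounds.exists_invariantProfile (h : ContractionBounds g ε σ c κ δ Λ η)
    (hg : Continuous g) (hper : Function.Periodic g (2 * Real.pi)) :
    ∃ P : ℝ → ℝ, IsInvariantProfile g ε σ c δ Λ P := by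
  have hc := h.rate_pos
  have hκ := h.speed_pos
  have hspeed : ∀ u s, |u| ≤ δ → 0 < σ * phaseRate₃ g ε 0 (Real.pi + u) (σ * s) :=
    fun u s hu => hκ.trans_le (h.speed_ge u _ hu)
  -- the difference of two slopes, multiplied by a speed
  have hdiff : ∀ u v s, |u| ≤ δ → |v| ≤ δ →
      (phaseSlope g ε σ u s - phaseSlope g ε σ v s) * (σ * phaseRate₃ g ε 0 (Real.pi + u) (σ * s)) =
      (phaseRate₂ g ε 0 (Real.pi + u) (σ * s) - phaseRate₂ g ε 0 (Real.pi + v) (σ * s)) -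
      phaseSlope g ε σ v s * (σ * phaseRate₃ g ε 0 (Real.pi + u) (σ * s) -
        σ * phaseRate₃ g ε 0 (Real.pi + v) (σ * s)) := by
    intro u v s hu hv
    have h1 : phaseSlope g ε σ u s * (σ * phaseRate₃ g ε 0 (Real.pi + u) (σ * s)) =
        phaseRate₂ g ε 0 (Real.pi + u) (σ * s) := div_mul_cancel₀ _ (hspeed u s hu).ne'
    have h2 : phaseSlope g ε σ v s * (σ * phaseRate₃ g ε 0 (Real.pi + v) (σ * s)) =
        phaseRate₂ g ε 0 (Real.pi + v) (σ * s) := div_mul_cancel₀ _ (hspeed v s hv).ne'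
    linear_combination h1 - h2
  have hcross : ∀ u v s, |v| ≤ δ →
      |phaseSlope g ε σ v s * (σ * phaseRate₃ g ε 0 (Real.pi + u) (σ * s) -
        σ * phaseRate₃ g ε 0 (Real.pi + v) (σ * s))| ≤ c / 8 * |u - v| := by
    intro u v s hv
    have h1 := h.abs_speed_sub_le 0 u v (σ * s)
    rw [abs_zero, zero_add] at h1
    rw [abs_mul]
    calc _ ≤ |phaseSlope g ε σ v s| * (Λ * |u - v|) := by gcongr
      _ = |phaseSlope g ε σ v s| * Λ * |u - v| := by ring
      _ ≤ _ := mul_le_mul_of_nonneg_right (h.abs_phaseSlope_mul_le hv s) (abs_nonneg _)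
  -- After the cross term there remains a rate of at least `c / 2` in the original time; dividing by
  -- a speed of at most `3 κ` gives `c / (6 κ)`. The forcing at `u = 0` is at most `Λ |ε| / κ`.
  obtain ⟨P, hP, hPC, hPd⟩ := exists_periodic_solution (F := phaseSlope g ε σ)
    (p := 2 * Real.pi) (c := c / (6 * κ)) (M := (Λ + c / 8) / κ) (δ := δ) (C := Λ * |ε| / κ)
    Real.two_pi_pos (by positivity) h.width_pos
    (by
      rw [div_le_iff₀ hκ, show c / (6 * κ) * δ * κ = c * δ / 6 by field_simp]
      have := h.small_coupling
      have := mul_nonneg h.lipschitz_nonneg (abs_nonneg ε)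
      linarith)
    (by
      refine ContinuousOn.div ?_ ?_ ?_
      · unfold phaseRate₂; fun_prop
      · unfold phaseRate₃; fun_prop
      · rintro ⟨u, s⟩ ⟨hu, -⟩
        exact (hspeed u s (abs_le.mpr hu)).ne')
    (fun u s => by
      have h2 := (phaseRate₂_periodic (ε := ε) hper 0 (Real.pi + u)).comp_sign_mul h.sign_sq s
      have h3 := (phaseRate₃_periodic (ε := ε) hper 0 (Real.pi + u)).comp_sign_mul h.sign_sq s
      simp only at h2 h3
      simp only [phaseSlope, h2, h3])
    (fun u v s hu hv => by
      have hk := hspeed u s hu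
      have h1 := h.contract₂ u v (σ * s) hu hv
      have h2 := mul_le_mul_of_nonneg_right (hcross u v s hv) (abs_nonneg (u - v))
      rw [← abs_mul, mul_assoc (c / 8), ← sq, sq_abs] at h2
      have h3 := neg_abs_le (phaseSlope g ε σ v s *
        (σ * phaseRate₃ g ε 0 (Real.pi + u) (σ * s) -
          σ * phaseRate₃ g ε 0 (Real.pi + v) (σ * s)) * (u - v))
      have h4 : (phaseSlope g ε σ u s - phaseSlope g ε σ v s) * (u - v) *
          (σ * phaseRate₃ g ε 0 (Real.pi + u) (σ * s)) ≤ -(c / 2) * (u - v) ^ 2 := by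
        rw [mul_right_comm, hdiff u v s hu hv, sub_mul]
        have := mul_nonneg hc.le (sq_nonneg (u - v))
        linarith
      have h5 : c / (6 * κ) * (u - v) ^ 2 * (σ * phaseRate₃ g ε 0 (Real.pi + u) (σ * s)) ≤
          c / 2 * (u - v) ^ 2 := by
        have h6 := mul_le_mul_of_nonneg_left (h.speed_le u (σ * s) hu)
          (by positivity : 0 ≤ c / (6 * κ) * (u - v) ^ 2)
        rwa [show c / (6 * κ) * (u - v) ^ 2 * (3 * κ) = c / 2 * (u - v) ^ 2 by
          field_simp; ring] at h6
      refine le_of_mul_le_mul_right ?_ hk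
      linarith)
    (fun u v s hu hv => by
      have hk := h.speed_ge u (σ * s) hu
      have h1 := h.lipschitz₂ u v (σ * s)
      have h2 := hcross u v s hv
      have h3 : |phaseSlope g ε σ u s - phaseSlope g ε σ v s| *
          |σ * phaseRate₃ g ε 0 (Real.pi + u) (σ * s)| ≤ Λ * |u - v| + c / 8 * |u - v| := by
        rw [← abs_mul, hdiff u v s hu hv]
        exact (abs_sub _ _).trans (add_le_add h1 h2)
      rw [abs_of_pos (hspeed u s hu)] at h3
      rw [div_mul_eq_mul_div, le_div_iff₀ hκ]
      have := mul_le_mul_of_nonneg_left hk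
        (abs_nonneg (phaseSlope g ε σ u s - phaseSlope g ε σ v s))
      linarith)
    (fun s => by
      have h0 : |(0 : ℝ)| ≤ δ := by simp [h.width_pos.le]
      have hk := h.speed_ge 0 (σ * s) h0
      rw [phaseSlope, abs_div, abs_of_pos (hspeed 0 s h0)]
      refine div_le_div₀ (mul_nonneg h.lipschitz_nonneg (abs_nonneg _)) ?_ hκ hk
      rw [add_zero]
      exact h.center₂ _)
  have hval : Λ * |ε| / κ / (c / (6 * κ)) = 6 * (Λ * |ε|) / c := by field_simp
  rw [hval] at hPC
  refine ⟨P, hP, hPC, fun s => (hPC s).trans ?_, hPd⟩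
  rw [div_le_iff₀ hc]
  linarith [h.small_coupling]

/-- The squared distance of the phase differences to the invariant curve is a Lyapunov function. -/
theorem ContractionBounds.lyapunov_deriv_le (h : ContractionBounds g ε σ c κ δ Λ η) {P : ℝ → ℝ}
    (hP : IsInvariantProfile g ε σ c δ Λ P) {x u s : ℝ} (hx : |x| ≤ δ) (hu : |u| ≤ δ) :
    2 * x * phaseRate₁ g ε x (Real.pi + u) (σ * s) +
      2 * (u - P s) * (phaseRate₂ g ε x (Real.pi + u) (σ * s) -
        phaseSlope g ε σ (P s) s * (σ * phaseRate₃ g ε x (Real.pi + u) (σ * s))) ≤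
      -c * (x ^ 2 + (u - P s) ^ 2) := by
  have hPδ : |P s| ≤ δ := (hP.abs_le_half s).trans (by linarith [h.width_pos])
  have hinv : phaseSlope g ε σ (P s) s * (σ * phaseRate₃ g ε 0 (Real.pi + P s) (σ * s)) =
      phaseRate₂ g ε 0 (Real.pi + P s) (σ * s) :=
    div_mul_cancel₀ _ (h.speed_pos.trans_le (h.speed_ge _ _ hPδ)).ne'
  set w := u - P s with hw
  have h1 := h.contract₁ x (Real.pi + u) (σ * s) hx
  have h2 := h.contract₂ u (P s) (σ * s) hu hPδ
  rw [← hw] at h2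
  have h3 := h.cross₂ x (Real.pi + u) (σ * s)
  have h4 : |phaseSlope g ε σ (P s) s * (σ * phaseRate₃ g ε x (Real.pi + u) (σ * s) -
      σ * phaseRate₃ g ε 0 (Real.pi + P s) (σ * s))| ≤ c / 8 * (|x| + |w|) := by
    have h5 := h.abs_speed_sub_le x u (P s) (σ * s)
    rw [abs_mul]
    calc _ ≤ |phaseSlope g ε σ (P s) s| * (Λ * (|x| + |w|)) := by gcongr
      _ = |phaseSlope g ε σ (P s) s| * Λ * (|x| + |w|) := by ring
      _ ≤ _ := mul_le_mul_of_nonneg_right (h.abs_phaseSlope_mul_le hPδ s) (by positivity)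
  have h6 := mul_le_mul_of_nonneg_left ((abs_sub _ _).trans (add_le_add h3 h4)) (abs_nonneg w)
  rw [← abs_mul] at h6
  have h7 := (le_abs_self _).trans h6
  -- Invariance of the curve (`hinv`) allows its own velocity to be subtracted. What remains is the
  -- contraction in `u` plus errors of size `c / 8` times `|x|` and `|x| + |w|`, absorbed by `h8`.
  have e : w * (phaseRate₂ g ε x (Real.pi + u) (σ * s) -
        phaseSlope g ε σ (P s) s * (σ * phaseRate₃ g ε x (Real.pi + u) (σ * s))) =
      (phaseRate₂ g ε 0 (Real.pi + u) (σ * s) - phaseRate₂ g ε 0 (Real.pi + P s) (σ * s)) * w +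
      w * ((phaseRate₂ g ε x (Real.pi + u) (σ * s) - phaseRate₂ g ε 0 (Real.pi + u) (σ * s)) -
        phaseSlope g ε σ (P s) s * (σ * phaseRate₃ g ε x (Real.pi + u) (σ * s) -
          σ * phaseRate₃ g ε 0 (Real.pi + P s) (σ * s))) := by
    linear_combination (-w) * hinv
  have h8 : c * (|x| * |w|) ≤ c * ((x ^ 2 + w ^ 2) / 2) := by
    refine mul_le_mul_of_nonneg_left ?_ h.rate_pos.le
    rw [← sq_abs x, ← sq_abs w]
    linarith [two_mul_le_add_sq |x| |w|]
  have h9 : |w| * |w| = w ^ 2 := by rw [← sq, sq_abs]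
  have h10 := mul_nonneg h.rate_pos.le (sq_nonneg x)
  have h11 := mul_nonneg h.rate_pos.le (sq_nonneg w)
  have h12 : |w| * (c / 8 * |x| + c / 8 * (|x| + |w|)) =
      c * (|x| * |w|) / 4 + c / 8 * w ^ 2 := by rw [← h9]; ring
  rw [h12] at h7
  linarith

end InvariantCurve

/-! ### The torus and its universal cover -/

section Torus

variable {N : ℕ}

theorem toTorus_eq_iff {v w : Fin N → ℝ} :
    toTorus v = toTorus w ↔ ∃ n : Fin N → ℤ, ∀ i, v i = w i + n i * (2 * Real.pi) := by
  have h : ∀ a b : ℝ, (a : AddCircle (2 * Real.pi)) = b ↔ ∃ n : ℤ, a = b + n * (2 * Real.pi) := by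
    intro a b
    rw [← sub_eq_zero, ← AddCircle.coe_sub, AddCircle.coe_eq_zero_iff]
    simp only [zsmul_eq_mul]
    exact exists_congr fun n => ⟨fun h => by linarith, fun h => by linarith⟩
  simp only [funext_iff, toTorus, h]
  exact Classical.skolem

theorem toTorus_surjective : Function.Surjective (toTorus : (Fin N → ℝ) → PhaseTorus N) :=
  fun p => ⟨fun i => (p i).out, funext fun _ => Quotient.out_eq _⟩

theorem continuous_toTorus : Continuous (toTorus : (Fin N → ℝ) → PhaseTorus N) :=
  continuous_pi fun i => (AddCircle.continuous_mk' _).comp (continuous_apply i)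

theorem isOpenMap_toTorus : IsOpenMap (toTorus : (Fin N → ℝ) → PhaseTorus N) :=
  IsOpenMap.piMap (fun _ => QuotientAddGroup.isOpenMap_coe)
    (Eventually.of_forall fun _ => Quotient.mk_surjective)

theorem dist_toTorus_le (v w : Fin N → ℝ) : dist (toTorus v) (toTorus w) ≤ dist v w := by
  refine (dist_pi_le_iff dist_nonneg).mpr fun i => le_trans ?_ (dist_le_pi_dist v w i)
  rw [dist_eq_norm, dist_eq_norm]
  exact QuotientAddGroup.norm_mk_le_norm

end Torus

/-! ### Existence, uniqueness and lifting of network trajectories -/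

namespace OscillatorNetwork

variable {N : ℕ} (S : OscillatorNetwork N)

/-- The vector field of the network on `ℝ^N`. -/
noncomputable def field (v : Fin N → ℝ) : Fin N → ℝ := fun i =>
  S.freq i + ∑ j, S.strength i j * S.coupling (v i - v j)

theorem isSolution_iff {θ : ℝ → Fin N → ℝ} :
    S.IsSolution θ ↔ ∀ t, HasDerivAt θ (S.field (θ t)) t :=
  forall_congr' fun _ => hasDerivAt_pi.symm

/-- The derivative of the coupling is continuous and periodic, hence bounded. -/
theorem exists_lipschitz_coupling : ∃ K : ℝ, ∀ a b, |S.coupling a - S.coupling b| ≤ K * |a - b| := by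
  have hd : Continuous (deriv S.coupling) := S.smooth.continuous_deriv (by simp)
  have hper : Function.Periodic (deriv S.coupling) (2 * Real.pi) := fun x => by
    rw [← deriv_comp_add_const, S.periodic.funext]
  obtain ⟨K, hK⟩ := hd.exists_abs_le_of_periodic Real.two_pi_pos.ne' hper
  refine ⟨K, fun a b => ?_⟩
  exact Convex.norm_image_sub_le_of_norm_deriv_le
    (fun x _ => (S.smooth.differentiable (by simp)).differentiableAt) (fun x _ => hK x)
    convex_univ (Set.mem_univ b) (Set.mem_univ a)

theorem exists_lipschitz_field : ∃ K : NNReal, LipschitzWith K S.field := by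
  obtain ⟨K, hK⟩ := S.exists_lipschitz_coupling
  have hK0 : 0 ≤ K := by simpa using (abs_nonneg _).trans (hK 1 0)
  have hC0 : 0 ≤ (∑ i, ∑ j, |S.strength i j|) * (2 * K) := by positivity
  refine ⟨⟨_, hC0⟩, LipschitzWith.of_dist_le_mul fun v w => ?_⟩
  refine (dist_pi_le_iff (by positivity)).mpr fun i => ?_
  change _ ≤ (∑ i, ∑ j, |S.strength i j|) * (2 * K) * dist v w
  have h1 : ∀ j, |S.strength i j * S.coupling (v i - v j) - S.strength i j * S.coupling (w i - w j)| ≤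
      |S.strength i j| * (2 * K * dist v w) := fun j => by
    rw [← mul_sub, abs_mul]
    refine mul_le_mul_of_nonneg_left ((hK _ _).trans ?_) (abs_nonneg _)
    have h2 := dist_le_pi_dist v w i
    have h3 := dist_le_pi_dist v w j
    rw [Real.dist_eq] at h2 h3
    have h4 := abs_sub (v i - w i) (v j - w j)
    rw [show v i - v j - (w i - w j) = v i - w i - (v j - w j) by ring]
    nlinarith
  calc dist (S.field v i) (S.field w i)
      = |∑ j, (S.strength i j * S.coupling (v i - v j) - S.strength i j * S.coupling (w i - w j))| := by
        rw [Real.dist_eq, Finset.sum_sub_distrib]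
        simp only [field]
        congr 1; ring
    _ ≤ ∑ j, |S.strength i j| * (2 * K * dist v w) :=
        (Finset.abs_sum_le_sum_abs _ _).trans (Finset.sum_le_sum fun j _ => h1 j)
    _ = (∑ j, |S.strength i j|) * (2 * K * dist v w) := by rw [Finset.sum_mul]
    _ ≤ (∑ i, ∑ j, |S.strength i j|) * (2 * K * dist v w) := by
        refine mul_le_mul_of_nonneg_right ?_ (by positivity)
        exact Finset.single_le_sum (f := fun i => ∑ j, |S.strength i j|)
          (fun i _ => Finset.sum_nonneg fun j _ => abs_nonneg _) (Finset.mem_univ i)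
    _ = _ := by ring

theorem exists_bound_field : ∃ C : NNReal, ∀ v, ‖S.field v‖ ≤ C := by
  obtain ⟨G, hG⟩ := S.smooth.continuous.exists_abs_le_of_periodic Real.two_pi_pos.ne' S.periodic
  have hG0 : 0 ≤ G := (abs_nonneg _).trans (hG 0)
  have hC0 : 0 ≤ ∑ i, (|S.freq i| + ∑ j, |S.strength i j| * G) := by positivity
  refine ⟨⟨_, hC0⟩, fun v => (pi_norm_le_iff_of_nonneg hC0).mpr fun i => ?_⟩
  refine le_trans ?_ (Finset.single_le_sum (f := fun i => |S.freq i| + ∑ j, |S.strength i j| * G)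
    (fun i _ => by positivity) (Finset.mem_univ i))
  refine (abs_add_le _ _).trans (add_le_add le_rfl ?_)
  refine (Finset.abs_sum_le_sum_abs _ _).trans (Finset.sum_le_sum fun j _ => ?_)
  rw [abs_mul]
  exact mul_le_mul_of_nonneg_left (hG _) (abs_nonneg _)

theorem exists_isSolution (v : Fin N → ℝ) : ∃ θ : ℝ → Fin N → ℝ, S.IsSolution θ ∧ θ 0 = v := by
  obtain ⟨K, hK⟩ := S.exists_lipschitz_field
  obtain ⟨C, hC⟩ := S.exists_bound_field
  obtain ⟨θ, h0, hθ⟩ := exists_global_integralCurve hK hC v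
  exact ⟨θ, S.isSolution_iff.mpr hθ, h0⟩

variable {S}

theorem IsSolution.eq {θ ψ : ℝ → Fin N → ℝ} (hθ : S.IsSolution θ) (hψ : S.IsSolution ψ)
    (h0 : θ 0 = ψ 0) : θ = ψ := by
  obtain ⟨K, hK⟩ := S.exists_lipschitz_field
  exact ODE_solution_unique_univ (v := fun _ => S.field) (s := fun _ => Set.univ) (t₀ := 0)
    (fun _ => hK.lipschitzOnWith) (fun t => ⟨S.isSolution_iff.mp hθ t, trivial⟩)
    (fun t => ⟨S.isSolution_iff.mp hψ t, trivial⟩) h0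

theorem IsSolution.add_period {θ : ℝ → Fin N → ℝ} (hθ : S.IsSolution θ) (n : Fin N → ℤ) :
    S.IsSolution fun t i => θ t i + n i * (2 * Real.pi) := fun t i => by
  refine ((hθ t i).add_const _).congr_deriv ?_
  congr 1
  refine Finset.sum_congr rfl fun j _ => ?_
  rw [show θ t i + n i * (2 * Real.pi) - (θ t j + n j * (2 * Real.pi)) =
    θ t i - θ t j + (n i - n j : ℤ) * (2 * Real.pi) by push_cast; ring,
    (S.periodic.int_mul (n i - n j)) _]

/-- Two solutions that start at the same point of the torus differ by a constant multiple of the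
period. -/
theorem IsSolution.exists_eq_add_period {θ ψ : ℝ → Fin N → ℝ} (hθ : S.IsSolution θ)
    (hψ : S.IsSolution ψ) (h0 : toTorus (θ 0) = toTorus (ψ 0)) :
    ∃ n : Fin N → ℤ, ∀ t i, θ t i = ψ t i + n i * (2 * Real.pi) := by
  obtain ⟨n, hn⟩ := toTorus_eq_iff.mp h0
  refine ⟨n, fun t i => ?_⟩
  rw [hθ.eq (hψ.add_period n) (funext hn)]

theorem IsSolution.continuous {θ : ℝ → Fin N → ℝ} (hθ : S.IsSolution θ) : Continuous θ :=
  continuous_iff_continuousAt.mpr fun t => (S.isSolution_iff.mp hθ t).continuousAt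

/-- A trajectory on the torus can be lifted from any lift of its initial point. -/
theorem IsSolution.exists_lift {θ : ℝ → Fin N → ℝ} (hθ : S.IsSolution θ) {v : Fin N → ℝ}
    (h0 : toTorus v = toTorus (θ 0)) :
    ∃ ψ, S.IsSolution ψ ∧ ψ 0 = v ∧ ∀ t, toTorus (ψ t) = toTorus (θ t) := by
  obtain ⟨n, hn⟩ := toTorus_eq_iff.mp h0
  exact ⟨_, hθ.add_period n, (funext hn).symm, fun t => toTorus_eq_iff.mpr ⟨n, fun i => rfl⟩⟩

end OscillatorNetwork

/-! ### Phase difference equations of the four oscillators -/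

section FourOscillators

variable {ω r α ε : ℝ} {θ : ℝ → Fin 4 → ℝ}

theorem fourOscillator_isSolution_iff : (fourOscillator ω r α ε).IsSolution θ ↔
    ∀ t,
      HasDerivAt (fun s => θ s 0) (ω + (hmmCoupling r α 0 + ε * hmmCoupling r α (θ t 0 - θ t 1) +
        hmmCoupling r α (θ t 0 - θ t 2) + ε * hmmCoupling r α (θ t 0 - θ t 3))) t ∧
      HasDerivAt (fun s => θ s 1) (ω + (ε * hmmCoupling r α (θ t 1 - θ t 0) + hmmCoupling r α 0 +
        ε * hmmCoupling r α (θ t 1 - θ t 2) + hmmCoupling r α (θ t 1 - θ t 3))) t ∧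
      HasDerivAt (fun s => θ s 2) (ω + (hmmCoupling r α (θ t 2 - θ t 0) +
        ε * hmmCoupling r α (θ t 2 - θ t 1) + hmmCoupling r α 0 +
        ε * hmmCoupling r α (θ t 2 - θ t 3))) t ∧
      HasDerivAt (fun s => θ s 3) (ω + (ε * hmmCoupling r α (θ t 3 - θ t 0) +
        hmmCoupling r α (θ t 3 - θ t 1) + ε * hmmCoupling r α (θ t 3 - θ t 2) +
        hmmCoupling r α 0)) t := by
  refine forall_congr' fun t => ?_
  simp [Fin.forall_fin_succ, Fin.sum_univ_four, fourOscillator]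

theorem hasDerivAt_phaseDiffs (hθ : (fourOscillator ω r α ε).IsSolution θ) (t : ℝ) :
    HasDerivAt (fun s => θ s 0 - θ s 2) (phaseRate₁ (hmmCoupling r α) ε (θ t 0 - θ t 2)
      (θ t 1 - θ t 3) (θ t 0 - θ t 1)) t ∧
    HasDerivAt (fun s => θ s 1 - θ s 3) (phaseRate₂ (hmmCoupling r α) ε (θ t 0 - θ t 2)
      (θ t 1 - θ t 3) (θ t 0 - θ t 1)) t ∧
    HasDerivAt (fun s => θ s 0 - θ s 1) (phaseRate₃ (hmmCoupling r α) ε (θ t 0 - θ t 2)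
      (θ t 1 - θ t 3) (θ t 0 - θ t 1)) t := by
  obtain ⟨h0, h1, h2, h3⟩ := fourOscillator_isSolution_iff.mp hθ t
  refine ⟨(h0.sub h2).congr_deriv ?_, (h1.sub h3).congr_deriv ?_, (h0.sub h1).congr_deriv ?_⟩
  · unfold phaseRate₁
    ring_nf
  · unfold phaseRate₂
    ring_nf
  · unfold phaseRate₃
    ring_nf

end FourOscillators

/-! ### Geometry of the invariant torus -/

section ChimeraTorus

/-- The state with first phase `a` whose phase differences are `(0, π + P s, σ s)`. -/
noncomputable def profileState (σ : ℝ) (P : ℝ → ℝ) (a s : ℝ) : Fin 4 → ℝ :=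
  ![a, a - σ * s, a, a - σ * s - (Real.pi + P s)]

/-- The closed curve of phase differences `(0, π + P s, σ s)`. -/
noncomputable def profileCurve (σ : ℝ) (P : ℝ → ℝ) (s : ℝ) : PhaseTorus 3 :=
  toTorus ![0, Real.pi + P s, σ * s]

/-- The states whose phase differences lie on the curve `(0, π + P s, σ s)`. -/
noncomputable def profileSet (σ : ℝ) (P : ℝ → ℝ) : Set (PhaseTorus 4) :=
  Set.range fun q : ℝ × ℝ => toTorus (profileState σ P q.1 q.2)

/-- The squared distance of the phase differences to the profile. -/
noncomputable def profileDistSq (σ : ℝ) (P : ℝ → ℝ) (v : Fin 4 → ℝ) : ℝ :=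
  (v 0 - v 2) ^ 2 + (v 1 - v 3 - Real.pi - P (σ * (v 0 - v 1))) ^ 2

variable {σ : ℝ} {P : ℝ → ℝ}

theorem phaseDiff_toTorus (v : Fin 4 → ℝ) :
    phaseDiff (toTorus v) = toTorus ![v 0 - v 2, v 1 - v 3, v 0 - v 1] := by
  funext i
  fin_cases i <;> rfl

theorem phaseDiff_profileState (a s : ℝ) :
    phaseDiff (toTorus (profileState σ P a s)) = profileCurve σ P s := by
  rw [phaseDiff_toTorus, profileCurve]
  congr 1
  simp [profileState]

theorem continuous_phaseDiff : Continuous phaseDiff := by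
  refine continuous_pi fun i => ?_
  fin_cases i
  · exact (continuous_apply (0 : Fin 4)).sub (continuous_apply (2 : Fin 4))
  · exact (continuous_apply (1 : Fin 4)).sub (continuous_apply (3 : Fin 4))
  · exact (continuous_apply (0 : Fin 4)).sub (continuous_apply (1 : Fin 4))

theorem profileSet_eq_preimage : profileSet σ P = phaseDiff ⁻¹' Set.range (profileCurve σ P) := by
  ext p
  constructor
  · rintro ⟨⟨a, s⟩, rfl⟩
    exact ⟨s, (phaseDiff_profileState a s).symm⟩
  · rintro ⟨s, hs⟩
    obtain ⟨v, rfl⟩ := toTorus_surjective p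
    rw [phaseDiff_toTorus, profileCurve, toTorus_eq_iff] at hs
    obtain ⟨n, hn⟩ := hs
    have h0 := hn 0
    have h1 := hn 1
    have h2 := hn 2
    simp only [Matrix.cons_val_zero, Matrix.cons_val_one, Matrix.cons_val] at h0 h1 h2
    refine ⟨(v 0, s), toTorus_eq_iff.mpr ⟨![0, -n 2, -n 0, -n 1 - n 2], fun i => ?_⟩⟩
    fin_cases i <;> simp [profileState] <;> linarith

theorem continuous_profileState (hP : Continuous P) :
    Continuous fun q : ℝ × ℝ => profileState σ P q.1 q.2 := by
  refine continuous_pi fun i => ?_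
  fin_cases i <;> simp [profileState] <;> fun_prop

theorem continuous_profileCurve (hP : Continuous P) : Continuous (profileCurve σ P) := by
  refine continuous_toTorus.comp (continuous_pi fun i => ?_)
  fin_cases i <;> simp <;> fun_prop

theorem profileCurve_periodic (hσ : σ * σ = 1) (hper : Function.Periodic P (2 * Real.pi)) :
    Function.Periodic (profileCurve σ P) (2 * Real.pi) := fun s => by
  rw [profileCurve, profileCurve, toTorus_eq_iff, hper s]
  rcases mul_self_eq_one_iff.mp hσ with rfl | rfl
  · refine ⟨![0, 0, 1], fun i => ?_⟩
    fin_cases i <;> simp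
  · refine ⟨![0, 0, -1], fun i => ?_⟩
    fin_cases i <;> simp
    ring

theorem isConnected_profileSet (hP : Continuous P) : IsConnected (profileSet σ P) :=
  isConnected_range (continuous_toTorus.comp (continuous_profileState hP))

/-- The curve is compact as the image of one period, and its preimage is closed in a compact torus.
-/
theorem isCompact_profileSet (hσ : σ * σ = 1) (hP : Continuous P)
    (hper : Function.Periodic P (2 * Real.pi)) : IsCompact (profileSet σ P) := by
  have : Fact (0 < 2 * Real.pi) := ⟨Real.two_pi_pos⟩
  rw [profileSet_eq_preimage]
  exact (((profileCurve_periodic hσ hper).compact_of_continuous Real.two_pi_pos.ne'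
    (continuous_profileCurve hP)).isClosed.preimage continuous_phaseDiff).isCompact

theorem profileDistSq_nonneg (v : Fin 4 → ℝ) : 0 ≤ profileDistSq σ P v := by
  unfold profileDistSq; positivity

theorem profileDistSq_profileState (hσ : σ * σ = 1) (a s : ℝ) :
    profileDistSq σ P (profileState σ P a s) = 0 := by
  have : σ * (a - (a - σ * s)) = s := by linear_combination s * hσ
  simp only [profileDistSq, profileState, Matrix.cons_val_zero, Matrix.cons_val_one,
    Matrix.cons_val, this]
  ring

theorem continuous_profileDistSq (hP : Continuous P) : Continuous (profileDistSq σ P) := by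
  unfold profileDistSq; fun_prop

/-- The comparison state shares `θ₁` and `θ₂` with `v`; the other two coordinates differ by the two
terms that are squared in `profileDistSq`. -/
theorem dist_profileState_le (hσ : σ * σ = 1) (v : Fin 4 → ℝ) :
    dist v (profileState σ P (v 0) (σ * (v 0 - v 1))) ≤ Real.sqrt (profileDistSq σ P v) := by
  refine (dist_pi_le_iff (Real.sqrt_nonneg _)).mpr fun i => ?_
  have e : σ * (σ * (v 0 - v 1)) = v 0 - v 1 := by rw [← mul_assoc, hσ, one_mul]
  rw [Real.dist_eq]
  fin_cases i
  · simp [profileState]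
  · simp [profileState, e]
  · refine Real.abs_le_sqrt ?_
    simp only [profileState, profileDistSq, Fin.reduceFinMk, Matrix.cons_val]
    nlinarith [sq_nonneg (v 1 - v 3 - Real.pi - P (σ * (v 0 - v 1)))]
  · refine Real.abs_le_sqrt ?_
    simp only [profileState, profileDistSq, Fin.reduceFinMk, Matrix.cons_val, e]
    nlinarith [sq_nonneg (v 0 - v 2)]

theorem toTorus_mem_profileSet (hσ : σ * σ = 1) {v : Fin 4 → ℝ} (hv : profileDistSq σ P v = 0) :
    toTorus v ∈ profileSet σ P := by
  have h := dist_profileState_le (P := P) hσ v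
  rw [hv, Real.sqrt_zero] at h
  exact ⟨(v 0, σ * (v 0 - v 1)), congrArg toTorus (dist_le_zero.mp h).symm⟩

theorem infDist_profileSet_le (hσ : σ * σ = 1) (v : Fin 4 → ℝ) :
    Metric.infDist (toTorus v) (profileSet σ P) ≤ Real.sqrt (profileDistSq σ P v) :=
  (Metric.infDist_le_dist_of_mem (Set.mem_range_self (v 0, σ * (v 0 - v 1)))).trans
    ((dist_toTorus_le _ _).trans (dist_profileState_le hσ v))

theorem inAntiPhaseSet_eq (hσ : σ * σ = 1) : inAntiPhaseSet = profileSet σ fun _ => 0 := by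
  rw [profileSet_eq_preimage]
  ext p
  simp only [inAntiPhaseSet, Set.mem_ofPred_eq, Set.mem_preimage, Set.mem_range, profileCurve,
    add_zero]
  constructor
  · rintro ⟨ξ, h⟩
    exact ⟨σ * ξ, by rw [h, ← mul_assoc, hσ, one_mul]⟩
  · rintro ⟨s, h⟩
    exact ⟨σ * s, h.symm⟩

end ChimeraTorus

/-! ### Dynamics on the invariant torus -/

section Dynamics

variable {ω r α ε σ c κ δ Λ η : ℝ} {P : ℝ → ℝ}

theorem IsInvariantProfile.continuous {g : ℝ → ℝ} (hP : IsInvariantProfile g ε σ c δ Λ P) :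
    Continuous P :=
  continuous_iff_continuousAt.mpr fun s => (hP.hasDerivAt s).continuousAt

/-- The trajectories on the invariant torus: the phase differences are periodic, and all phases
gain the same amount per period. -/
theorem exists_solution_on_profile (h : ContractionBounds (hmmCoupling r α) ε σ c κ δ Λ η)
    (hP : IsInvariantProfile (hmmCoupling r α) ε σ c δ Λ P) :
    ∃ T > 0, ∀ a₀ s₀ : ℝ, ∃ (a s : ℝ → ℝ) (ρ : ℝ), a 0 = a₀ ∧ s 0 = s₀ ∧ Continuous s ∧
      (∀ t, s (t + T) = s t + 2 * Real.pi) ∧ (∀ t, a (t + T) = a t + ρ) ∧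
      (fourOscillator ω r α ε).IsSolution fun t => profileState σ P (a t) (s t) := by
  set g := hmmCoupling r α with hgdef
  have hg : Continuous g := (hmmCoupling_smooth r α).continuous
  have hgper : Function.Periodic g (2 * Real.pi) := hmmCoupling_periodic r α
  have hPc := hP.continuous
  have hPδ : ∀ s, |P s| ≤ δ := fun s => (hP.abs_le_half s).trans (by linarith [h.width_pos])
  have hpos : ∀ s, 0 < σ * phaseRate₃ g ε 0 (Real.pi + P s) (σ * s) := fun s =>
    h.speed_pos.trans_le (h.speed_ge _ _ (hPδ s))
  obtain ⟨T, τ, hT, hτ, hτT, hsurj⟩ := exists_periodic_scalar_flow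
    (k := fun s => σ * phaseRate₃ g ε 0 (Real.pi + P s) (σ * s)) (p := 2 * Real.pi)
    (by unfold phaseRate₃; fun_prop) hpos Real.two_pi_pos (fun s => by
      simp only [hP.periodic s]
      exact congrArg (σ * ·)
        ((phaseRate₃_periodic (ε := ε) hgper 0 (Real.pi + P s)).comp_sign_mul h.sign_sq s))
  refine ⟨T, hT, fun a₀ s₀ => ?_⟩
  -- All motions along the curve are time shifts of one flow, so `T` does not depend on the initial
  -- state.
  obtain ⟨t₀, ht₀⟩ := hsurj s₀
  let s : ℝ → ℝ := fun t => τ (t + t₀)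
  have hs : ∀ t, HasDerivAt s (σ * phaseRate₃ g ε 0 (Real.pi + P (s t)) (σ * s t)) t := fun t =>
    (hτ (t + t₀)).comp_add_const t t₀
  have hsc : Continuous s := continuous_iff_continuousAt.mpr fun t => (hs t).continuousAt
  have hsT : ∀ t, s (t + T) = s t + 2 * Real.pi := fun t => by
    simp only [s, add_right_comm t T t₀, hτT]
  -- The common velocity of `θ₁` and `θ₃` on the torus; its integral over one period is `ρ`.
  let q : ℝ → ℝ := fun s => ω + (g 0 + ε * g (σ * s) + g 0 + ε * g (σ * s + (Real.pi + P s)))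
  have hqc : Continuous fun t => q (s t) := by fun_prop
  have hqT : Function.Periodic (fun t => q (s t)) T := fun t => by
    have e1 := hgper.comp_sign_mul h.sign_sq (s t)
    have e2 : Function.Periodic (fun z => g (z + (Real.pi + P (s t)))) (2 * Real.pi) := fun z => by
      simp only [add_right_comm z, hgper _]
    have e3 := e2.comp_sign_mul h.sign_sq (s t)
    simp only at e1 e3
    simp only [q, hsT, hP.periodic _, e1, e3]
  let a : ℝ → ℝ := fun t => a₀ + ∫ τ in (0 : ℝ)..t, q (s τ)
  have ha : ∀ t, HasDerivAt a (q (s t)) t := fun t =>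
    (intervalIntegral.integral_hasDerivAt_right (hqc.intervalIntegrable _ _)
      (hqc.stronglyMeasurableAtFilter _ _) hqc.continuousAt).const_add a₀
  refine ⟨a, s, ∫ τ in (0 : ℝ)..T, q (s τ), by simp [a], by simp [s, ht₀], hsc, hsT, fun t => ?_, ?_⟩
  · have := hqT.intervalIntegral_add_eq_add 0 t fun _ _ => hqc.intervalIntegrable _ _
    simp only [zero_add] at this
    simp only [a, this, add_assoc]
  rw [fourOscillator_isSolution_iff]
  intro t
  have h1 : HasDerivAt (fun t => a t - σ * s t)
      (q (s t) - phaseRate₃ g ε 0 (Real.pi + P (s t)) (σ * s t)) t := by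
    refine ((ha t).sub ((hs t).const_mul σ)).congr_deriv ?_
    linear_combination (-phaseRate₃ g ε 0 (Real.pi + P (s t)) (σ * s t)) * h.sign_sq
  have h3 : HasDerivAt (fun t => a t - σ * s t - (Real.pi + P (s t)))
      (q (s t) - phaseRate₃ g ε 0 (Real.pi + P (s t)) (σ * s t) -
        phaseRate₂ g ε 0 (Real.pi + P (s t)) (σ * s t)) t := by
    refine (h1.sub (((hP.hasDerivAt (s t)).comp t (hs t)).const_add Real.pi)).congr_deriv ?_
    have : phaseSlope g ε σ (P (s t)) (s t) *
        (σ * phaseRate₃ g ε 0 (Real.pi + P (s t)) (σ * s t)) =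
        phaseRate₂ g ε 0 (Real.pi + P (s t)) (σ * s t) := div_mul_cancel₀ _ (hpos _).ne'
    rw [this]
  simp only [profileState, Matrix.cons_val_zero, Matrix.cons_val_one, Matrix.cons_val, ← hgdef]
  refine ⟨(ha t).congr_deriv ?_, h1.congr_deriv ?_, (ha t).congr_deriv ?_, h3.congr_deriv ?_⟩
  · simp only [q]; ring_nf
  · simp only [q, phaseRate₃]; ring_nf
  · simp only [q]; ring_nf
  · simp only [q, phaseRate₂, phaseRate₃]; ring_nf

/-- Every trajectory that meets the invariant torus is one of those of
`exists_solution_on_profile`. -/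
theorem exists_eq_profileState (h : ContractionBounds (hmmCoupling r α) ε σ c κ δ Λ η)
    (hP : IsInvariantProfile (hmmCoupling r α) ε σ c δ Λ P) :
    ∃ T > 0, ∀ θ : ℝ → Fin 4 → ℝ, (fourOscillator ω r α ε).IsSolution θ →
      toTorus (θ 0) ∈ profileSet σ P → ∃ (a s : ℝ → ℝ) (ρ : ℝ) (n : Fin 4 → ℤ), Continuous s ∧
      (∀ t, s (t + T) = s t + 2 * Real.pi) ∧ (∀ t, a (t + T) = a t + ρ) ∧
      ∀ t i, θ t i = profileState σ P (a t) (s t) i + n i * (2 * Real.pi) := by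
  obtain ⟨T, hT, hsol⟩ := exists_solution_on_profile (ω := ω) h hP
  refine ⟨T, hT, fun θ hθ hmem => ?_⟩
  obtain ⟨⟨a₀, s₀⟩, hq⟩ := hmem
  obtain ⟨a, s, ρ, ha, hs, hsc, hsT, haT, hψ⟩ := hsol a₀ s₀
  obtain ⟨n, hn⟩ := hθ.exists_eq_add_period hψ (by simp only [ha, hs]; exact hq.symm)
  exact ⟨a, s, ρ, n, hsc, hsT, haT, hn⟩

theorem flowInvariant_profileSet (h : ContractionBounds (hmmCoupling r α) ε σ c κ δ Λ η)
    (hP : IsInvariantProfile (hmmCoupling r α) ε σ c δ Λ P) :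
    (fourOscillator ω r α ε).FlowInvariant (profileSet σ P) := by
  obtain ⟨T, -, hsol⟩ := exists_eq_profileState (ω := ω) h hP
  intro θ hθ h0 t
  obtain ⟨a, s, ρ, n, -, -, -, hn⟩ := hsol θ hθ h0
  exact ⟨(a t, s t), (toTorus_eq_iff.mpr ⟨n, hn t⟩).symm⟩

theorem frequencies_on_profileSet (h : ContractionBounds (hmmCoupling r α) ε σ c κ δ Λ η)
    (hP : IsInvariantProfile (hmmCoupling r α) ε σ c δ Λ P) {θ : ℝ → Fin 4 → ℝ}
    (hθ : (fourOscillator ω r α ε).IsSolution θ) (h0 : toTorus (θ 0) ∈ profileSet σ P) :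
    (∀ t : ℝ, toTorus (θ t) 0 = toTorus (θ t) 2) ∧
      HasFrequencyDifference θ 0 2 0 ∧ HasFrequencyDifference θ 1 3 0 ∧
      ∃ c : ℝ, c ≠ 0 ∧ HasFrequencyDifference θ 0 1 c := by
  obtain ⟨T, hT, hsol⟩ := exists_eq_profileState (ω := ω) h hP
  obtain ⟨a, s, ρ, n, hsc, hsT, -, hn⟩ := hsol θ hθ h0
  refine ⟨fun t => ?_, ?_, ?_, σ * (2 * Real.pi / T), ?_, ?_⟩
  · have e : toTorus (θ t) = toTorus (profileState σ P (a t) (s t)) :=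
      toTorus_eq_iff.mpr ⟨n, hn t⟩
    rw [e]
    rfl
  · refine tendsto_div_atTop_zero_of_bounded (C := |(n 0 - n 2 : ℝ) * (2 * Real.pi)|) fun t => ?_
    rw [hn, hn]
    simp only [profileState, Matrix.cons_val_zero, Matrix.cons_val]
    exact le_of_eq (congrArg _ (by ring))
  · refine tendsto_div_atTop_zero_of_bounded
      (C := |Real.pi + (n 1 - n 3 : ℝ) * (2 * Real.pi)| + δ / 2) fun t => ?_
    rw [hn, hn]
    simp only [profileState, Matrix.cons_val_one, Matrix.cons_val]
    rw [show a t - σ * s t + n 1 * (2 * Real.pi) - (a t - σ * s t - (Real.pi + P (s t)) +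
      n 3 * (2 * Real.pi)) = Real.pi + (n 1 - n 3 : ℝ) * (2 * Real.pi) + P (s t) by ring]
    exact (abs_add_le _ _).trans (add_le_add le_rfl (hP.abs_le_half _))
  · have : σ ≠ 0 := fun h' => by simpa [h'] using h.sign_sq
    exact mul_ne_zero this (div_ne_zero Real.two_pi_pos.ne' hT.ne')
  · have h1 := (tendsto_div_atTop_of_add_period hsc hT.ne' hsT).const_mul σ
    have h2 := tendsto_div_atTop_zero_of_bounded (f := fun _ => (n 0 - n 1 : ℝ) * (2 * Real.pi))
      fun _ => le_rfl
    have h3 := h1.add h2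
    rw [add_zero] at h3
    refine h3.congr fun t => ?_
    rw [hn, hn]
    simp only [profileState, Matrix.cons_val_zero, Matrix.cons_val_one]
    ring

/-- Every point of the invariant torus is recurrent. -/
theorem chainRecurrentOn_profileSet (h : ContractionBounds (hmmCoupling r α) ε σ c κ δ Λ η)
    (hP : IsInvariantProfile (hmmCoupling r α) ε σ c δ Λ P) :
    (fourOscillator ω r α ε).ChainRecurrentOn (profileSet σ P) := by
  have : Fact (0 < 2 * Real.pi) := ⟨Real.two_pi_pos⟩
  obtain ⟨T, hT, hsol⟩ := exists_solution_on_profile (ω := ω) h hP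
  rintro x ⟨⟨a₀, s₀⟩, rfl⟩ d hd τ hτ
  obtain ⟨a, s, ρ, ha, hs, hsc, hsT, haT, hψ⟩ := hsol a₀ s₀
  refine .single ⟨⟨_, rfl⟩, ⟨_, rfl⟩, _, hψ, by simp only [ha, hs], ?_⟩
  -- A single link suffices. The factor `m` makes the flow time at least `τ`, and `k` makes the
  -- Dirichlet error for the multiples of `m ρ` modulo `2π` less than `d`.
  obtain ⟨m, hm⟩ := exists_nat_ge (τ / T)
  have hm0 : 0 < m := by
    have : (0 : ℝ) < m := (div_pos hτ hT).trans_le hm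
    exact_mod_cast this
  obtain ⟨k, hk⟩ := exists_nat_gt (2 * Real.pi / d)
  have hk0 : 0 < k := by
    have : (0 : ℝ) < k := (div_pos Real.two_pi_pos hd).trans hk
    exact_mod_cast this
  obtain ⟨j, hj, hjn⟩ := AddCircle.exists_norm_nsmul_le ((m : ℕ) • (ρ : AddCircle (2 * Real.pi))) hk0
  have hj1 : (1 : ℝ) ≤ j := by exact_mod_cast hj.1
  have hsN : ∀ N : ℕ, s (N * T) = s₀ + N * (2 * Real.pi) := fun N => by
    induction N with
    | zero => simp [hs]
    | succ N ih => rw [Nat.cast_succ, add_one_mul, hsT, ih]; ring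
  have haN : ∀ N : ℕ, a (N * T) = a₀ + N * ρ := fun N => by
    induction N with
    | zero => simp [ha]
    | succ N ih => rw [Nat.cast_succ, add_one_mul, haT, ih]; ring
  have hsmall : ‖(((j * m : ℕ) * ρ : ℝ) : AddCircle (2 * Real.pi))‖ < d := by
    have e : (((j * m : ℕ) * ρ : ℝ) : AddCircle (2 * Real.pi)) =
        j • m • (ρ : AddCircle (2 * Real.pi)) := by
      rw [smul_smul, ← AddCircle.coe_nsmul, nsmul_eq_mul]
    rw [e]
    refine hjn.trans_lt ?_
    rw [div_lt_iff₀ hd] at hk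
    rw [div_lt_iff₀ (by positivity)]
    push_cast
    nlinarith
  refine ⟨(j * m : ℕ) * T, ?_, ?_⟩
  · rw [div_le_iff₀ hT] at hm
    push_cast
    have : (0 : ℝ) ≤ m * T := by positivity
    nlinarith
  · have hPN : P (s₀ + (j * m : ℕ) * (2 * Real.pi)) = P s₀ := hP.periodic.nat_mul (j * m) s₀
    obtain ⟨l, hl⟩ : ∃ l : ℤ, (l : ℝ) = σ * (j * m : ℕ) := by
      rcases mul_self_eq_one_iff.mp h.sign_sq with rfl | rfl
      · exact ⟨(j * m : ℕ), by push_cast; ring⟩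
      · exact ⟨-(j * m : ℕ), by push_cast; ring⟩
    have e : toTorus (profileState σ P (a ((j * m : ℕ) * T)) (s ((j * m : ℕ) * T))) =
        toTorus fun i => profileState σ P a₀ s₀ i + (j * m : ℕ) * ρ := by
      rw [haN, hsN, toTorus_eq_iff]
      refine ⟨![0, -l, 0, -l], fun i => ?_⟩
      fin_cases i <;> simp [profileState, hl] <;> push_cast at hPN ⊢ <;> try rw [hPN]
      all_goals ring
    rw [e]
    refine (dist_pi_lt_iff hd).mpr fun i => ?_
    rw [dist_eq_norm]
    simp only [toTorus]
    rw [← AddCircle.coe_sub, add_sub_cancel_left]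
    exact hsmall

theorem isPhaseDiffPeriodicOrbit_profileCurve
    (h : ContractionBounds (hmmCoupling r α) ε σ c κ δ Λ η)
    (hP : IsInvariantProfile (hmmCoupling r α) ε σ c δ Λ P) :
    IsPhaseDiffPeriodicOrbit (fourOscillator ω r α ε) (Set.range (profileCurve σ P)) := by
  obtain ⟨T, hT, hsol⟩ := exists_solution_on_profile (ω := ω) h hP
  obtain ⟨a, s, ρ, -, hs0, hsc, hsT, -, hψ⟩ := hsol 0 0
  -- The orbit must run through the whole curve for its range to be the range of `profileCurve`.
  have hsurj : Function.Surjective s := by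
    intro y
    have hsN : ∀ N : ℤ, s (N * T) = N * (2 * Real.pi) := fun N => by
      have hper : Function.Periodic (fun t => s t - 2 * Real.pi / T * t) T := fun t => by
        simp only [hsT]; field_simp; ring
      have := hper.int_mul N 0
      simp only [zero_add, hs0, mul_zero, sub_zero] at this
      rw [sub_eq_zero.mp this]
      field_simp
    obtain ⟨N, hN⟩ := exists_nat_ge (|y| / (2 * Real.pi))
    rw [div_le_iff₀ Real.two_pi_pos] at hN
    have h1 := hsN N
    have h2 := hsN (-N)
    push_cast at h1 h2
    obtain ⟨t, -, ht⟩ := intermediate_value_uIcc (a := -(N : ℝ) * T) (b := N * T) hsc.continuousOn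
      (show y ∈ _ from Set.mem_uIcc_of_le (by rw [h2]; linarith [neg_abs_le y])
        (by rw [h1]; linarith [le_abs_self y]))
    exact ⟨t, ht⟩
  refine ⟨_, hψ, ⟨T, hT, fun t => ?_⟩, ?_, ?_⟩
  · simp only [phaseDiff_profileState, hsT]
    exact profileCurve_periodic h.sign_sq hP.periodic _
  -- At `s = 1` the third phase difference is `σ = ±1`, which is not a multiple of `2π`.
  · obtain ⟨t, ht⟩ := hsurj 1
    refine ⟨t, fun heq => ?_⟩
    simp only [phaseDiff_profileState, ht, hs0] at heq
    obtain ⟨n, hn⟩ := toTorus_eq_iff.mp heq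
    have h2 := hn 2
    simp only [Matrix.cons_val, mul_one, mul_zero, zero_add] at h2
    have h3 := h.sign_abs
    rw [h2, abs_mul, abs_of_pos Real.two_pi_pos] at h3
    rcases eq_or_ne (n 2) 0 with h4 | h4
    · simp [h4] at h3
    · have h5 : (1 : ℝ) ≤ |(n 2 : ℝ)| := by exact_mod_cast Int.one_le_abs h4
      nlinarith [Real.pi_gt_three]
  · simp only [phaseDiff_profileState]
    exact (hsurj.range_comp (profileCurve σ P)).symm

end Dynamics

/-! ### Attraction, isolation and continuity in `ε` -/

section Stability

variable {ω r α ε σ c κ δ Λ η : ℝ} {P : ℝ → ℝ} {θ : ℝ → Fin 4 → ℝ}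

theorem hasDerivAt_profileDistSq (h : ContractionBounds (hmmCoupling r α) ε σ c κ δ Λ η)
    (hP : IsInvariantProfile (hmmCoupling r α) ε σ c δ Λ P)
    (hθ : (fourOscillator ω r α ε).IsSolution θ) :
    ∃ V' : ℝ → ℝ, (∀ t, HasDerivAt (fun t => profileDistSq σ P (θ t)) (V' t) t) ∧
      ∀ t, |θ t 0 - θ t 2| ≤ δ → |θ t 1 - θ t 3 - Real.pi| ≤ δ →
        V' t ≤ -c * profileDistSq σ P (θ t) := by
  have key : ∀ t, ∃ d, HasDerivAt (fun t => profileDistSq σ P (θ t)) d t ∧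
      (|θ t 0 - θ t 2| ≤ δ → |θ t 1 - θ t 3 - Real.pi| ≤ δ →
        d ≤ -c * profileDistSq σ P (θ t)) := by
    intro t
    obtain ⟨hx, hy, hz⟩ := hasDerivAt_phaseDiffs hθ t
    have hs := hz.const_mul σ
    have hPs := (hP.hasDerivAt (σ * (θ t 0 - θ t 1))).comp t hs
    refine ⟨_, (hx.pow 2).add (((hy.sub_const Real.pi).sub hPs).pow 2), fun h1 h2 => ?_⟩
    have h3 := h.lyapunov_deriv_le hP (s := σ * (θ t 0 - θ t 1)) h1 h2
    rw [← mul_assoc σ σ, h.sign_sq, one_mul, add_sub_cancel] at h3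
    refine le_trans (le_of_eq ?_) h3
    simp only [Pi.sub_apply, Function.comp_apply]
    ring
  choose V' hV hV' using key
  exact ⟨V', hV, hV'⟩

/-- The threshold `(δ / 2) ^ 2` together with `|P| ≤ δ / 2` keeps `|x|` and `|y - π|` within `δ`,
where the Lyapunov estimate is valid. -/
theorem profileDistSq_decay (h : ContractionBounds (hmmCoupling r α) ε σ c κ δ Λ η)
    (hP : IsInvariantProfile (hmmCoupling r α) ε σ c δ Λ P)
    (hθ : (fourOscillator ω r α ε).IsSolution θ) (h0 : profileDistSq σ P (θ 0) < (δ / 2) ^ 2)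
    {t : ℝ} (ht : 0 ≤ t) :
    profileDistSq σ P (θ t) ≤ profileDistSq σ P (θ 0) * Real.exp (-(c / 2) * t) := by
  obtain ⟨V', hV, hV'⟩ := hasDerivAt_profileDistSq h hP hθ
  refine le_exp_decay_of_deriv_le h.rate_pos hV (fun t hlt => hV' t ?_ ?_)
    (fun t => profileDistSq_nonneg _) h0 ht
  · have h1 : (θ t 0 - θ t 2) ^ 2 < (δ / 2) ^ 2 := lt_of_le_of_lt
      (le_add_of_nonneg_right (sq_nonneg _)) hlt
    have := abs_lt_of_sq_lt_sq h1 (by linarith [h.width_pos])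
    linarith [h.width_pos]
  · have h1 : (θ t 1 - θ t 3 - Real.pi - P (σ * (θ t 0 - θ t 1))) ^ 2 < (δ / 2) ^ 2 := lt_of_le_of_lt
      (le_add_of_nonneg_left (sq_nonneg _)) hlt
    have h2 := abs_lt_of_sq_lt_sq h1 (by linarith [h.width_pos])
    have h3 := abs_add_le (θ t 1 - θ t 3 - Real.pi - P (σ * (θ t 0 - θ t 1)))
      (P (σ * (θ t 0 - θ t 1)))
    rw [sub_add_cancel] at h3
    linarith [hP.abs_le_half (σ * (θ t 0 - θ t 1))]

/-- The image on the torus of a sublevel set of `profileDistSq`. -/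
noncomputable def profileNhd (σ : ℝ) (P : ℝ → ℝ) (b : ℝ) : Set (PhaseTorus 4) :=
  toTorus '' {v | profileDistSq σ P v < b}

theorem isOpen_profileNhd (hP : Continuous P) (b : ℝ) : IsOpen (profileNhd σ P b) :=
  isOpenMap_toTorus _ (isOpen_lt (continuous_profileDistSq hP) continuous_const)

theorem profileSet_subset_profileNhd (hσ : σ * σ = 1) {b : ℝ} (hb : 0 < b) :
    profileSet σ P ⊆ profileNhd σ P b := by
  rintro _ ⟨⟨a, s⟩, rfl⟩
  exact ⟨_, (profileDistSq_profileState hσ a s).trans_lt hb, rfl⟩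

/-- Since `profileDistSq` depends on the lift, the neighbourhoods are images of its sublevel sets,
and each trajectory is lifted from a representative with small value. -/
theorem isAttracting_profileSet (h : ContractionBounds (hmmCoupling r α) ε σ c κ δ Λ η)
    (hP : IsInvariantProfile (hmmCoupling r α) ε σ c δ Λ P) :
    (fourOscillator ω r α ε).IsAttracting (profileSet σ P) := by
  have hcpt := isCompact_profileSet h.sign_sq hP.continuous hP.periodic
  have hδ : 0 < (δ / 2) ^ 2 := by have := h.width_pos; positivity
  refine ⟨hcpt, flowInvariant_profileSet h hP, fun V hV hAV => ?_, ?_⟩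
  · obtain ⟨d, hd, hdV⟩ := hcpt.exists_thickening_subset_open hV hAV
    have hb : 0 < min ((δ / 2) ^ 2) (d ^ 2) := lt_min hδ (by positivity)
    refine ⟨profileNhd σ P (min ((δ / 2) ^ 2) (d ^ 2)), isOpen_profileNhd hP.continuous _,
      profileSet_subset_profileNhd h.sign_sq hb, fun θ hθ h0 t ht => hdV ?_⟩
    obtain ⟨v, hv, hvθ⟩ := h0
    obtain ⟨ψ, hψ, rfl, hψθ⟩ := hθ.exists_lift hvθ
    rw [← hψθ t]
    have h1 := profileDistSq_decay h hP hψ (lt_of_lt_of_le hv (min_le_left _ _)) ht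
    have h2 : Real.exp (-(c / 2) * t) ≤ 1 :=
      Real.exp_le_one_iff.mpr (by nlinarith [h.rate_pos])
    have h3 : profileDistSq σ P (ψ t) < d ^ 2 := by
      have := mul_le_of_le_one_right (profileDistSq_nonneg (σ := σ) (P := P) (ψ 0)) h2
      exact (h1.trans this).trans_lt (lt_of_lt_of_le hv (min_le_right _ _))
    refine Metric.mem_thickening_iff.mpr ⟨_, Set.mem_range_self (ψ t 0, σ * (ψ t 0 - ψ t 1)), ?_⟩
    refine ((dist_toTorus_le _ _).trans (dist_profileState_le h.sign_sq _)).trans_lt ?_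
    rwa [Real.sqrt_lt' hd]
  · refine ⟨profileNhd σ P ((δ / 2) ^ 2), isOpen_profileNhd hP.continuous _,
      profileSet_subset_profileNhd h.sign_sq hδ, fun θ hθ h0 => ?_⟩
    obtain ⟨v, hv, hvθ⟩ := h0
    obtain ⟨ψ, hψ, rfl, hψθ⟩ := hθ.exists_lift hvθ
    simp only [← hψθ]
    have hc := h.rate_pos
    have hlim : Tendsto (fun t : ℝ => Real.sqrt (profileDistSq σ P (ψ 0) * Real.exp (-(c / 2 * t))))
        atTop (𝓝 (Real.sqrt (profileDistSq σ P (ψ 0) * 0))) :=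
      ((Real.tendsto_exp_neg_atTop_nhds_zero.comp
        (tendsto_id.const_mul_atTop (half_pos hc))).const_mul _).sqrt
    rw [mul_zero, Real.sqrt_zero] at hlim
    refine tendsto_of_tendsto_of_tendsto_of_le_of_le' tendsto_const_nhds hlim
      (Eventually.of_forall fun t => Metric.infDist_nonneg) ?_
    filter_upwards [eventually_ge_atTop 0] with t ht
    refine (infDist_profileSet_le h.sign_sq _).trans (Real.sqrt_le_sqrt ?_)
    have := profileDistSq_decay h hP hψ hv ht
    rwa [neg_mul] at this

/-- The states with `|θ₁ - θ₃| < δ` and `|θ₂ - θ₄ - π| < δ`. -/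
noncomputable def isolatingNhd (δ : ℝ) : Set (PhaseTorus 4) :=
  toTorus '' {v | |v 0 - v 2| < δ ∧ |v 1 - v 3 - Real.pi| < δ}

theorem isOpen_isolatingNhd (δ : ℝ) : IsOpen (isolatingNhd δ) := by
  have h1 : IsOpen {v : Fin 4 → ℝ | |v 0 - v 2| < δ} := isOpen_lt (by fun_prop) continuous_const
  have h2 : IsOpen {v : Fin 4 → ℝ | |v 1 - v 3 - Real.pi| < δ} :=
    isOpen_lt (by fun_prop) continuous_const
  exact isOpenMap_toTorus _ (h1.inter h2)

theorem profileSet_subset_isolatingNhd (hδ : 0 < δ) (hP : ∀ s, |P s| ≤ δ / 2) :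
    profileSet σ P ⊆ isolatingNhd δ := by
  rintro _ ⟨⟨a, s⟩, rfl⟩
  refine ⟨_, ⟨?_, ?_⟩, rfl⟩
  · simpa [profileState] using hδ
  · simp only [profileState, Matrix.cons_val_one, Matrix.cons_val]
    rw [show a - σ * s - (a - σ * s - (Real.pi + P s)) - Real.pi = P s by ring]
    linarith [hP s]

/-- An orbit inside the neighbourhood for all times has a lift that cannot jump to another sheet,
because `2 δ < 2π`. Its Lyapunov function is then bounded and decays along the full orbit, so it
vanishes. -/
theorem subset_profileSet_of_flowInvariant
    (h : ContractionBounds (hmmCoupling r α) ε σ c κ δ Λ η)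
    (hP : IsInvariantProfile (hmmCoupling r α) ε σ c δ Λ P) (hδ : δ ≤ 1) {B : Set (PhaseTorus 4)}
    (hBU : B ⊆ isolatingNhd δ) (hB : (fourOscillator ω r α ε).FlowInvariant B) :
    B ⊆ profileSet σ P := by
  intro p hp
  obtain ⟨v, ⟨hv1, hv2⟩, rfl⟩ := hBU hp
  obtain ⟨θ, hθ, rfl⟩ := (fourOscillator ω r α ε).exists_isSolution v
  have hlift : ∀ t, ∃ m n : ℤ, |θ t 0 - θ t 2 - m * (2 * Real.pi)| < δ ∧
      |θ t 1 - θ t 3 - Real.pi - n * (2 * Real.pi)| < δ := fun t => by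
    obtain ⟨w, ⟨h1, h2⟩, hw⟩ := hBU (hB θ hθ hp t)
    obtain ⟨n, hn⟩ := toTorus_eq_iff.mp hw.symm
    refine ⟨n 0 - n 2, n 1 - n 3, ?_, ?_⟩
    · rw [hn 0, hn 2]
      push_cast
      convert h1 using 2
      ring
    · rw [hn 1, hn 3]
      push_cast
      convert h2 using 2
      ring
  have hπ : 2 * δ < 2 * Real.pi := by linarith [Real.pi_gt_three]
  have hc : ∀ i, Continuous fun t => θ t i := fun i => (continuous_apply i).comp hθ.continuous
  have hx := forall_abs_sub_lt_of_continuous (x := fun t => θ t 0 - θ t 2)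
    ((hc 0).sub (hc 2)) hπ hv1 fun t => (hlift t).imp fun m ⟨_, h, _⟩ => h
  have hu := forall_abs_sub_lt_of_continuous (x := fun t => θ t 1 - θ t 3 - Real.pi)
    (((hc 1).sub (hc 3)).sub continuous_const) hπ hv2 fun t =>
      let ⟨_, n, _, h⟩ := hlift t
      ⟨n, h⟩
  obtain ⟨V', hV, hV'⟩ := hasDerivAt_profileDistSq h hP hθ
  refine toTorus_mem_profileSet h.sign_sq (eq_zero_of_deriv_le_of_bounded
    (V := fun t => profileDistSq σ P (θ t)) (b := δ ^ 2 + (δ + δ / 2) ^ 2) h.rate_pos hV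
    (fun t => hV' t (hx t).le (hu t).le) (fun t => profileDistSq_nonneg _) fun t => ?_)
  refine add_le_add (sq_le_sq' ?_ ?_) (sq_le_sq' ?_ ?_)
  all_goals
    have h1 := abs_lt.mp (hx t)
    have h2 := abs_lt.mp (hu t)
    have h3 := abs_le.mp (hP.abs_le_half (σ * (θ t 0 - θ t 1)))
    linarith

theorem hausdorffEDist_profileSet_le {Q : ℝ → ℝ} {b : ℝ} (hPQ : ∀ s, |P s - Q s| ≤ b) :
    Metric.hausdorffEDist (profileSet σ P) (profileSet σ Q) ≤ ENNReal.ofReal b := by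
  have key : ∀ {P Q : ℝ → ℝ}, (∀ s, |P s - Q s| ≤ b) → ∀ a s,
      edist (toTorus (profileState σ P a s)) (toTorus (profileState σ Q a s)) ≤
        ENNReal.ofReal b := fun {P Q} hPQ a s => by
    rw [edist_dist]
    refine ENNReal.ofReal_le_ofReal ((dist_toTorus_le _ _).trans ?_)
    have hb : 0 ≤ b := (abs_nonneg _).trans (hPQ 0)
    refine (dist_pi_le_iff hb).mpr fun i => ?_
    have e : a - σ * s - (Real.pi + P s) - (a - σ * s - (Real.pi + Q s)) = -(P s - Q s) := by ring
    rw [Real.dist_eq]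
    fin_cases i
    on_goal 4 =>
      simp only [profileState, Fin.reduceFinMk, Matrix.cons_val]
      rw [e, abs_neg]
      exact hPQ s
    all_goals simpa [profileState] using hb
  refine Metric.hausdorffEDist_le_of_mem_edist ?_ ?_
  · rintro _ ⟨⟨a, s⟩, rfl⟩
    exact ⟨_, Set.mem_range_self (a, s), key hPQ a s⟩
  · rintro _ ⟨⟨a, s⟩, rfl⟩
    exact ⟨_, Set.mem_range_self (a, s), key (fun s => by rw [abs_sub_comm]; exact hPQ s) a s⟩

theorem isWeakChimera_profileSet (h : ContractionBounds (hmmCoupling r α) ε σ c κ δ Λ η)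
    (hP : IsInvariantProfile (hmmCoupling r α) ε σ c δ Λ P) :
    (fourOscillator ω r α ε).IsWeakChimera (profileSet σ P) where
  connected := isConnected_profileSet hP.continuous
  invariant := flowInvariant_profileSet h hP
  chainRecurrent := chainRecurrentOn_profileSet h hP
  partialSync θ hθ hmem := by
    obtain ⟨-, h02, -, h01⟩ := frequencies_on_profileSet h hP hθ (hmem 0)
    exact ⟨0, 1, 2, by decide, h01, h02⟩

end Stability

/-! ### The Hansel–Mato–Meunier coupling and its parameter region -/

section HanselMatoMeunier

theorem mem_chimeraRegion_iff {r α : ℝ} :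
    (r, α) ∈ chimeraRegion ↔ r < -|Real.cos α| / 2 ∧ Real.sin α ≠ 0 := by
  refine and_congr_right fun _ => ?_
  rw [Ne, Real.sin_eq_zero_iff, not_exists]
  exact forall_congr' fun k => ⟨fun h h' => h h'.symm, fun h h' => h h'.symm⟩

theorem isOpen_chimeraRegion : IsOpen chimeraRegion := by
  have : chimeraRegion = {p : ℝ × ℝ | p.1 < -|Real.cos p.2| / 2} ∩ {p | Real.sin p.2 ≠ 0} := by
    ext ⟨r, α⟩
    exact mem_chimeraRegion_iff
  rw [this]
  exact (isOpen_lt (by fun_prop) (by fun_prop)).inter (isOpen_ne_fun (by fun_prop) (by fun_prop))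

theorem chimeraRegion_nonempty : chimeraRegion.Nonempty :=
  ⟨(-1, Real.pi / 2), mem_chimeraRegion_iff.mpr (by norm_num)⟩

theorem hmmCoupling_lipschitz (r α a b : ℝ) :
    |hmmCoupling r α a - hmmCoupling r α b| ≤ (1 + 2 * |r|) * |a - b| := by
  have hs : ∀ x y : ℝ, |Real.sin x - Real.sin y| ≤ |x - y| := fun x y => by
    have h1 : ∀ x, ‖deriv Real.sin x‖ ≤ 1 := fun x => by
      rw [Real.deriv_sin]; exact Real.abs_cos_le_one x
    have := Convex.norm_image_sub_le_of_norm_deriv_le (f := Real.sin)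
      (fun x _ => Real.differentiable_sin x) (fun x _ => h1 x) convex_univ
      (Set.mem_univ y) (Set.mem_univ x)
    rwa [one_mul] at this
  have h1 := hs (b - α) (a - α)
  rw [sub_sub_sub_cancel_right, abs_sub_comm b a] at h1
  have h2 := hs (2 * a) (2 * b)
  rw [← mul_sub, abs_mul 2, abs_two] at h2
  have e : hmmCoupling r α a - hmmCoupling r α b = (Real.sin (b - α) - Real.sin (a - α)) +
      r * (Real.sin (2 * a) - Real.sin (2 * b)) := by unfold hmmCoupling; ring
  rw [e]
  refine (abs_add_le _ _).trans ?_
  rw [abs_mul]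
  have := mul_le_mul_of_nonneg_left h2 (abs_nonneg r)
  linarith

theorem abs_hmmCoupling_le (r α a : ℝ) : |hmmCoupling r α a| ≤ 1 + 2 * |r| := by
  unfold hmmCoupling
  refine (abs_add_le _ _).trans ?_
  rw [abs_neg, abs_mul]
  have h1 := Real.abs_sin_le_one (a - α)
  have h2 := mul_le_mul_of_nonneg_left (Real.abs_sin_le_one (2 * a)) (abs_nonneg r)
  linarith [abs_nonneg r]

theorem hasStrictDerivAt_hmmCoupling_odd (r α x : ℝ) :
    HasStrictDerivAt (fun x => hmmCoupling r α x - hmmCoupling r α (-x))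
      (-2 * Real.cos α * Real.cos x + 4 * r * Real.cos (2 * x)) x := by
  have e : (fun x => hmmCoupling r α x - hmmCoupling r α (-x)) =
      fun x => -2 * Real.cos α * Real.sin x + 2 * r * Real.sin (2 * x) := by
    funext x
    unfold hmmCoupling
    rw [Real.sin_sub, Real.sin_sub, mul_neg, Real.sin_neg, Real.sin_neg, Real.cos_neg]
    ring
  rw [e]
  have h1 := (Real.hasStrictDerivAt_sin x).const_mul (-2 * Real.cos α)
  have h2 := (((hasStrictDerivAt_id x).const_mul 2).sin).const_mul (2 * r)
  refine (h1.add h2).congr_deriv ?_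
  simp only [id]
  ring

theorem exists_contractionBounds_hmmCoupling {r α : ℝ} (h : (r, α) ∈ chimeraRegion) :
    ∃ σ c κ δ Λ η ε₀ : ℝ, δ ≤ 1 ∧ 0 < ε₀ ∧
      ∀ ε, |ε| < ε₀ → ContractionBounds (hmmCoupling r α) ε σ c κ δ Λ η := by
  obtain ⟨hr, hs⟩ := mem_chimeraRegion_iff.mp h
  obtain ⟨σ, hσ, hσs⟩ : ∃ σ : ℝ, σ * σ = 1 ∧ σ * Real.sin α = |Real.sin α| := by
    rcases le_total 0 (Real.sin α) with h0 | h0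
    · exact ⟨1, by norm_num, by rw [abs_of_nonneg h0, one_mul]⟩
    · exact ⟨-1, by norm_num, by rw [abs_of_nonpos h0, neg_one_mul]⟩
  have hc1 := le_abs_self (Real.cos α)
  have hc2 := neg_abs_le (Real.cos α)
  have h0 := hasStrictDerivAt_hmmCoupling_odd r α 0
  have hπ := hasStrictDerivAt_hmmCoupling_odd r α Real.pi
  -- Here `-m₁` and `-m₂` are the derivatives of `g(x) - g(-x)` at `0` and `π`, and `2 κ = 2 |sin
  -- α|` is the uncoupled speed of `σ z`.
  obtain ⟨c, δ, Λ, η, ε₀, hδ, hε₀, H⟩ := exists_contractionBounds (κ := |Real.sin α|)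
    (m₁ := 2 * Real.cos α - 4 * r) (m₂ := -2 * Real.cos α - 4 * r)
    (hmmCoupling_lipschitz r α) (abs_hmmCoupling_le r α) (by positivity)
    (hmmCoupling_periodic r α) hσ (abs_pos.mpr hs)
    (by
      have : hmmCoupling r α 0 - hmmCoupling r α Real.pi = 2 * Real.sin α := by
        unfold hmmCoupling
        rw [Real.sin_pi_sub, zero_sub, Real.sin_neg, Real.sin_two_pi, mul_zero, Real.sin_zero]
        ring
      rw [this, ← hσs]; ring)
    (by linarith) (by linarith)
    (h0.congr_deriv (by simp only [mul_zero, Real.cos_zero]; ring))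
    (hπ.congr_deriv (by rw [Real.cos_two_pi, Real.cos_pi]; ring))
  exact ⟨σ, c, _, δ, Λ, η, ε₀, hδ, hε₀, H⟩

/-- In the uncoupled case the phase differences rotate along `(0, π, ξ)` with speed `2 sin α`. -/
theorem phaseDiff_uncoupled {ω r α ξ : ℝ} {θ : ℝ → Fin 4 → ℝ}
    (hθ : (fourOscillator ω r α 0).IsSolution θ)
    (h0 : phaseDiff (toTorus (θ 0)) = toTorus ![0, Real.pi, ξ]) (t : ℝ) :
    phaseDiff (toTorus (θ t)) = toTorus ![0, Real.pi, 2 * Real.sin α * t + ξ] := by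
  have g0 : hmmCoupling r α 0 = Real.sin α := by simp [hmmCoupling]
  have gπ : hmmCoupling r α Real.pi = -Real.sin α := by simp [hmmCoupling]
  have gnπ : hmmCoupling r α (-Real.pi) = -Real.sin α := by
    rw [← gπ, ← hmmCoupling_periodic r α (-Real.pi)]
    congr 1; ring
  -- Oscillators `1, 3` rotate with frequency `ω + 2 g(0)` and `2, 4` with `ω + g(0) + g(π) = ω`;
  -- uniqueness identifies the given solution with this one.
  let ψ : ℝ → Fin 4 → ℝ := fun t => ![θ 0 0 + (ω + 2 * Real.sin α) * t, θ 0 0 - ξ + ω * t,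
    θ 0 0 + (ω + 2 * Real.sin α) * t, θ 0 0 - ξ - Real.pi + ω * t]
  have hlin : ∀ a b t : ℝ, HasDerivAt (fun t => a + b * t) b t := fun a b t => by
    simpa using ((hasDerivAt_id t).const_mul b).const_add a
  have hψ : (fourOscillator ω r α 0).IsSolution ψ := by
    rw [fourOscillator_isSolution_iff]
    intro t
    simp only [ψ, Matrix.cons_val_zero, Matrix.cons_val_one, Matrix.cons_val, zero_mul, add_zero,
      zero_add, sub_self, g0]
    rw [show θ 0 0 - ξ + ω * t - (θ 0 0 - ξ - Real.pi + ω * t) = Real.pi by ring,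
      show θ 0 0 - ξ - Real.pi + ω * t - (θ 0 0 - ξ + ω * t) = -Real.pi by ring, gπ, gnπ]
    refine ⟨(hlin _ _ t).congr_deriv ?_, (hlin _ _ t).congr_deriv ?_, (hlin _ _ t).congr_deriv ?_,
      (hlin _ _ t).congr_deriv ?_⟩ <;> ring
  have hψ0 : toTorus (θ 0) = toTorus (ψ 0) := by
    rw [phaseDiff_toTorus] at h0
    obtain ⟨n, hn⟩ := toTorus_eq_iff.mp h0
    have h1 := hn 0
    have h2 := hn 1
    have h3 := hn 2
    simp only [Matrix.cons_val_zero, Matrix.cons_val_one, Matrix.cons_val] at h1 h2 h3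
    refine toTorus_eq_iff.mpr ⟨![0, -n 2, -n 0, -n 1 - n 2], fun i => ?_⟩
    fin_cases i <;> simp [ψ] <;> linarith
  obtain ⟨n, hn⟩ := hθ.exists_eq_add_period hψ hψ0
  rw [toTorus_eq_iff.mpr ⟨n, hn t⟩, phaseDiff_toTorus]
  congr 1
  funext i
  fin_cases i <;> simp [ψ]
  ring

end HanselMatoMeunier

theorem theorem2 :
    IsOpen chimeraRegion ∧ chimeraRegion.Nonempty ∧
    ∀ r α : ℝ, (r, α) ∈ chimeraRegion →
      -- the orbit `(0, π, 2 sin α · t + ξ)` at `ε = 0`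
      (∀ (ω ξ : ℝ) (θ : ℝ → Fin 4 → ℝ), (fourOscillator ω r α 0).IsSolution θ →
        phaseDiff (toTorus (θ 0)) = toTorus ![0, Real.pi, ξ] →
        ∀ t : ℝ, phaseDiff (toTorus (θ t)) =
          toTorus ![0, Real.pi, 2 * Real.sin α * t + ξ]) ∧
      -- it is an attracting weak chimera and continues as such, as an isolated invariant set
      ∃ ε₀ : ℝ, 0 < ε₀ ∧ ∃ (A : ℝ → Set (PhaseTorus 4)) (U : Set (PhaseTorus 4)), IsOpen U ∧
        A 0 = inAntiPhaseSet ∧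
        Tendsto (fun ε : ℝ => Metric.hausdorffEDist (A ε) (A 0)) (𝓝 0) (𝓝 0) ∧
        ∀ ε : ℝ, |ε| < ε₀ → ∀ ω : ℝ,
          (fourOscillator ω r α ε).IsWeakChimera (A ε) ∧
          (fourOscillator ω r α ε).IsAttracting (A ε) ∧
          (∃ γ : Set (PhaseTorus 3),
            IsPhaseDiffPeriodicOrbit (fourOscillator ω r α ε) γ ∧ A ε = phaseDiff ⁻¹' γ) ∧
          (A ε ⊆ U ∧ ∀ B ⊆ U, (fourOscillator ω r α ε).FlowInvariant B → B ⊆ A ε) ∧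
          -- one pair stays exactly in phase, each pair is frequency synchronized, and the two
          -- pairs have different frequencies
          ∀ θ : ℝ → Fin 4 → ℝ, (fourOscillator ω r α ε).IsSolution θ →
            toTorus (θ 0) ∈ A ε →
            (∀ t : ℝ, toTorus (θ t) 0 = toTorus (θ t) 2) ∧
            HasFrequencyDifference θ 0 2 0 ∧ HasFrequencyDifference θ 1 3 0 ∧
            ∃ c : ℝ, c ≠ 0 ∧ HasFrequencyDifference θ 0 1 c := by
  refine ⟨isOpen_chimeraRegion, chimeraRegion_nonempty, fun r α hrα =>
    ⟨fun ω ξ θ hθ h0 t => phaseDiff_uncoupled hθ h0 t, ?_⟩⟩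
  obtain ⟨σ, c, κ, δ, Λ, η, ε₀, hδ, hε₀, H⟩ := exists_contractionBounds_hmmCoupling hrα
  -- The profile is chosen for each `ε` before `ω` is introduced, so `A_ε` is independent of `ω`;
  -- outside `|ε| < ε₀` its value is irrelevant.
  have hprofile : ∀ ε, ∃ P : ℝ → ℝ, |ε| < ε₀ →
      IsInvariantProfile (hmmCoupling r α) ε σ c δ Λ P := fun ε => by
    by_cases hε : |ε| < ε₀
    · obtain ⟨P, hP⟩ := (H ε hε).exists_invariantProfile (hmmCoupling_smooth r α).continuous
        (hmmCoupling_periodic r α)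
      exact ⟨P, fun _ => hP⟩
    · exact ⟨0, fun h => absurd h hε⟩
  choose P hP using hprofile
  have h00 : |(0 : ℝ)| < ε₀ := by rwa [abs_zero]
  have hσ : σ * σ = 1 := (H 0 h00).sign_sq
  -- The bound `|P| ≤ 6 Λ |ε| / c` forces the profile to vanish at `ε = 0`; the same bound gives the
  -- Hausdorff convergence.
  have hP0 : P 0 = fun _ => 0 := funext fun s => by
    have := (hP 0 h00).abs_le s
    rw [abs_zero, mul_zero, mul_zero, zero_div] at this
    exact abs_nonpos_iff.mp this
  refine ⟨ε₀, hε₀, fun ε => profileSet σ (P ε), isolatingNhd δ, isOpen_isolatingNhd δ, ?_, ?_,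
    fun ε hε ω => ?_⟩
  · rw [inAntiPhaseSet_eq hσ, ← hP0]
  · have hlim : Tendsto (fun ε : ℝ => ENNReal.ofReal (6 * (Λ * |ε|) / c)) (𝓝 0) (𝓝 0) := by
      have h1 : Continuous fun ε : ℝ => ENNReal.ofReal (6 * (Λ * |ε|) / c) :=
        ENNReal.continuous_ofReal.comp (by fun_prop)
      have h2 := h1.tendsto 0
      simpa using h2
    refine tendsto_of_tendsto_of_tendsto_of_le_of_le' tendsto_const_nhds hlim
      (Eventually.of_forall fun _ => zero_le) ?_
    filter_upwards [(continuous_abs.tendsto (0 : ℝ)).eventually_lt_const h00] with ε hε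
    refine hausdorffEDist_profileSet_le fun s => ?_
    rw [hP0, sub_zero]
    exact (hP ε hε).abs_le s
  · have h := H ε hε
    exact ⟨isWeakChimera_profileSet h (hP ε hε), isAttracting_profileSet h (hP ε hε),
      ⟨_, isPhaseDiffPeriodicOrbit_profileCurve h (hP ε hε), profileSet_eq_preimage⟩,
      ⟨profileSet_subset_isolatingNhd h.width_pos (hP ε hε).abs_le_half,
        fun B hBU hB => subset_profileSet_of_flowInvariant h (hP ε hε) hδ hBU hB⟩,
      fun θ hθ h0 => frequencies_on_profileSet h (hP ε hε) hθ h0⟩
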